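/- Let $a_1,\dots,a_4$ be non-negative integers and let $b_1,\dots,b_4$ be positive integers with $\{b_1,b_2,b_3,b_4\}=\{1,1,1,2\}$ as multisets, ordered so that $$-\frac{a_1}{b_1}\ \ge\ -\frac{a_2}{b_2}\ \ge\ -\frac{a_3}{b_3}\ \ge\ -\frac{a_4}{b_4}.$$ Let $\mathcal F=(\mathbb C^6\setminus V(I))/(\mathbb C^*)^2$ be the toric variety of rank two with Cox ring $\mathbb C[u,v,x_1,x_2,x_3,x_4]$, irrelevant ideal $I=(u,v)\cap(x_1,x_2,x_3,x_4)$, and action of $(\mathbb C^*)^2$ with weights $$\begin{pmatrix}1&1&-a_1&-a_2&-a_3&-a_4\\ 0&0&b_1&b_2&b_3&b_4\end{pmatrix},$$ that is, $(\lambda,\mu)$ acts by $u\mapsto\lambda u$, $v\mapsto\lambda v$, $x_i\mapsto\lambda^{-a_i}\mu^{b_i}x_i$. Let $D_u,D_v,D_i$ be the prime divisors of $\mathcal F$ defined by $(u=0)$, $(v=0)$, $(x_i=0)$. Let $N^1(\mathcal F)_{\mathbb R}$ be the real vector space of divisors modulo numerical equivalence. Then: (i) the pseudo-effective cone of $\mathcal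 F$, i.e. the closure in $N^1(\mathcal F)_{\mathbb R}$ of the convex cone generated by the classes of effective divisors, is the convex cone generated by the classes of $D_u$ and $D_4$; (ii) the mobile cone $\mathrm{Mob}(\mathcal F)$, i.e. the convex cone in $N^1(\mathcal F)_{\mathbb R}$ generated by the classes of mobile divisors (Weil divisors $D$ such that for some $m>0$ the linear system $|mD|$ is non-empty and has no fixed component), is the convex cone generated by the classes of $D_u$ and $D_3$. -/

import Mathlib

open MvPolynomial TopologicalSpace

noncomputable section

namespace RankTwoToric

/-- Indices of the Cox coordinates: `inl 0, inl 1` are `u, v` and `inr 0, …, inr 3` are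
`x₁, …, x₄`. -/
abbrev Var : Type := Fin 2 ⊕ Fin 4

/-- The Cox ring `ℂ[u, v, x₁, x₂, x₃, x₄]`. -/
abbrev Cox : Type := MvPolynomial Var ℂ

/-- The weights of the Cox coordinates, i.e. the columns of the matrix
`(1 1 -a₁ -a₂ -a₃ -a₄ ; 0 0 b₁ b₂ b₃ b₄)`. -/
def weights (a b : Fin 4 → ℕ) : Var → ℤ × ℤ
  | Sum.inl _ => (1, 0)
  | Sum.inr i => (-(a i : ℤ), (b i : ℤ))

/-- The ratio weight `-aᵢ / bᵢ` of the Cox coordinate `xᵢ` (the ratio weight of `u` and `v` is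
`1 / 0 = ∞`, larger than all of these). -/
def ratioWeight (a b : Fin 4 → ℕ) (i : Fin 4) : ℚ := -(a i : ℚ) / (b i : ℚ)

/-- The irrelevant ideal `(u, v) ∩ (x₁, x₂, x₃, x₄)`. -/
def irrelevantIdeal : Ideal Cox :=
  Ideal.span (Set.range fun i : Fin 2 => X (Sum.inl i)) ⊓
    Ideal.span (Set.range fun i : Fin 4 => X (Sum.inr i))

/-- The open subset `ℂ⁶ ∖ V(I)`, where `I` is the irrelevant ideal. -/
abbrev CoxOpen : Type := {z : Var → ℂ // z ∉ zeroLocus ℂ irrelevantIdeal}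

/-- The character `(λ, μ) ↦ λ ^ d₁ * μ ^ d₂` of the torus `(ℂˣ)²`. -/
def torusChar (d : ℤ × ℤ) (t : ℂˣ × ℂˣ) : ℂˣ := t.1 ^ d.1 * t.2 ^ d.2

lemma torusChar_one (d : ℤ × ℤ) : torusChar d 1 = 1 := by simp [torusChar]

lemma torusChar_mul (d : ℤ × ℤ) (s t : ℂˣ × ℂˣ) :
    torusChar d (s * t) = torusChar d s * torusChar d t := by
  simp only [torusChar, Prod.fst_mul, Prod.snd_mul, mul_zpow]
  exact mul_mul_mul_comm _ _ _ _

lemma torusChar_zero (t : ℂˣ × ℂˣ) : torusChar 0 t = 1 := by simp [torusChar]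

lemma torusChar_add (d e : ℤ × ℤ) (t : ℂˣ × ℂˣ) :
    torusChar (d + e) t = torusChar d t * torusChar e t := by
  simp only [torusChar, Prod.fst_add, Prod.snd_add, zpow_add]
  exact mul_mul_mul_comm _ _ _ _

lemma torusChar_nsmul (n : ℕ) (d : ℤ × ℤ) (t : ℂˣ × ℂˣ) :
    torusChar (n • d) t = torusChar d t ^ n := by
  induction n with
  | zero => simp [torusChar_zero]
  | succ n ih => rw [succ_nsmul, torusChar_add, ih, pow_succ]

lemma torusChar_sum {ι : Type*} (s : Finset ι) (d : ι → ℤ × ℤ) (t : ℂˣ × ℂˣ) :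
    torusChar (∑ i ∈ s, d i) t = ∏ i ∈ s, torusChar (d i) t := by
  classical
  induction s using Finset.induction_on with
  | empty => simp [torusChar_zero]
  | insert i s hi ih => rw [Finset.sum_insert hi, Finset.prod_insert hi, torusChar_add, ih]

/-- The action of the torus `(ℂˣ)²` on `ℂ⁶` with weights `w`. -/
def torusAct (w : Var → ℤ × ℤ) (t : ℂˣ × ℂˣ) (z : Var → ℂ) : Var → ℂ :=
  fun j => (torusChar (w j) t : ℂ) * z j

lemma eval_torusAct {w : Var → ℤ × ℤ} {p : Cox} {d : ℤ × ℤ}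
    (hp : IsWeightedHomogeneous w p d) (t : ℂˣ × ℂˣ) (z : Var → ℂ) :
    eval (torusAct w t z) p = (torusChar d t : ℂ) * eval z p := by
  rw [eval_eq', eval_eq', Finset.mul_sum]
  refine Finset.sum_congr rfl fun k hk => ?_
  have hk' : Finsupp.weight w k = d := hp (mem_support_iff.mp hk)
  have hd : (torusChar d t : ℂ) = ∏ j, (torusChar (w j) t : ℂ) ^ k j := by
    rw [← hk', Finsupp.weight_apply, Finsupp.sum_fintype _ _ (by simp), torusChar_sum]
    rw [Units.coe_prod]
    exact Finset.prod_congr rfl fun j _ => by rw [torusChar_nsmul, Units.val_pow_eq_pow_val]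
  simp only [torusAct, mul_pow, Finset.prod_mul_distrib, hd]
  ring

/-- Two points of `ℂ⁶ ∖ V(I)` are equivalent if they lie in the same torus orbit. -/
def orbitSetoid (w : Var → ℤ × ℤ) : Setoid CoxOpen where
  r z z' := ∃ t : ℂˣ × ℂˣ, torusAct w t z.1 = z'.1
  iseqv :=
    { refl := fun z => ⟨1, by funext j; simp [torusAct, torusChar_one]⟩
      symm := by
        rintro z z' ⟨t, ht⟩
        refine ⟨t⁻¹, ?_⟩
        rw [← ht]
        funext j
        simp only [torusAct]
        rw [← mul_assoc, ← Units.val_mul, ← torusChar_mul]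
        simp [torusChar_one]
      trans := by
        rintro z z' z'' ⟨t, ht⟩ ⟨s, hs⟩
        refine ⟨s * t, ?_⟩
        rw [← hs, ← ht]
        funext j
        simp only [torusAct]
        rw [torusChar_mul, Units.val_mul, mul_assoc] }

/-- The toric variety `(ℂ⁶ ∖ V(I)) / (ℂˣ)²`, as the space of its closed points. -/
def Variety (w : Var → ℤ × ℤ) : Type := Quotient (orbitSetoid w)

/-- The quotient map `ℂ⁶ ∖ V(I) → 𝓕`. -/
def quot (w : Var → ℤ × ℤ) (z : CoxOpen) : Variety w := Quotient.mk (orbitSetoid w) z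

/-- The Zariski topology of `ℂ⁶`: the closed sets are the zero loci of ideals. -/
@[reducible] def zariskiTopology : TopologicalSpace (Var → ℂ) :=
  TopologicalSpace.ofClosed {Z | ∃ J : Ideal Cox, Z = zeroLocus ℂ J}
    ⟨⊤, by
      refine (Set.eq_empty_iff_forall_notMem.mpr fun z hz => ?_).symm
      simpa using hz 1 trivial⟩
    (by
      intro A hA
      refine ⟨⨆ J ∈ {J : Ideal Cox | zeroLocus ℂ J ∈ A}, J, ?_⟩
      ext z
      constructor
      · intro hz
        have hle : (⨆ J ∈ {J : Ideal Cox | zeroLocus ℂ J ∈ A}, J) ≤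
            RingHom.ker (aeval z : Cox →ₐ[ℂ] ℂ) :=
          iSup₂_le fun J hJ p hp => hz _ hJ p hp
        exact fun p hp => hle hp
      · intro hz Z hZ
        obtain ⟨J, rfl⟩ := hA hZ
        exact fun p hp => hz p ((le_iSup₂_of_le J hZ le_rfl :
          J ≤ ⨆ J ∈ {J : Ideal Cox | zeroLocus ℂ J ∈ A}, J) hp))
    (by
      rintro _ ⟨J, rfl⟩ _ ⟨J', rfl⟩
      refine ⟨J ⊓ J', ?_⟩
      ext z
      constructor
      · rintro (hz | hz) p hp
        · exact hz p hp.1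
        · exact hz p hp.2
      · intro hz
        by_contra hcon
        simp only [Set.mem_union, not_or, mem_zeroLocus_iff, not_forall] at hcon
        obtain ⟨⟨p, hp, hpz⟩, q, hq, hqz⟩ := hcon
        have := hz (p * q) ⟨J.mul_mem_right q hp, J'.mul_mem_left p hq⟩
        rw [map_mul] at this
        exact (mul_ne_zero hpz hqz) this)

/-- The Zariski topology of the toric variety: the quotient topology of the subspace topology
on `ℂ⁶ ∖ V(I)`. -/
instance (w : Var → ℤ × ℤ) : TopologicalSpace (Variety w) :=
  TopologicalSpace.coinduced (quot w) (TopologicalSpace.induced Subtype.val zariskiTopology)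

/-- The locus where a homogeneous polynomial does not vanish. -/
def nonvanishing (w : Var → ℤ × ℤ) (q : Cox) : Set (Variety w) :=
  {x | ∃ z : CoxOpen, quot w z = x ∧ eval z.1 q ≠ 0}

lemma quot_mem_nonvanishing {w : Var → ℤ × ℤ} {q : Cox} {d : ℤ × ℤ}
    (hq : IsWeightedHomogeneous w q d) (z : CoxOpen) :
    quot w z ∈ nonvanishing w q ↔ eval z.1 q ≠ 0 := by
  constructor
  · rintro ⟨z', hz', h⟩
    obtain ⟨t, ht⟩ : ∃ t, torusAct w t z'.1 = z.1 := Quotient.exact hz'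
    rw [← ht, eval_torusAct hq]
    exact mul_ne_zero (Units.ne_zero _) h
  · exact fun h => ⟨z, rfl, h⟩

lemma isOpen_nonvanishing {w : Var → ℤ × ℤ} {q : Cox} {d : ℤ × ℤ}
    (hq : IsWeightedHomogeneous w q d) : IsOpen (nonvanishing w q) := by
  refine isOpen_coinduced.mpr
    ((@isOpen_induced_iff _ _ zariskiTopology _ _).mpr ⟨{z | eval z q ≠ 0}, ?_, ?_⟩)
  · refine ⟨Ideal.span {q}, ?_⟩
    ext z
    simp only [Set.mem_compl_iff, Set.mem_ofPred_eq, not_not, mem_zeroLocus_iff]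
    constructor
    · intro h p hp
      obtain ⟨r, rfl⟩ := Ideal.mem_span_singleton.mp hp
      rw [map_mul, aeval_eq_eval]
      change eval z q * eval z r = 0
      rw [h, zero_mul]
    · intro h
      simpa [aeval_eq_eval] using h q (Ideal.mem_span_singleton_self q)
  · ext z
    exact (quot_mem_nonvanishing hq z).symm

/-- The field `ℂ(u, v, x₁, …, x₄)`. -/
abbrev CoxField : Type := FractionRing Cox

/-- `f` is a fraction `p / q` of homogeneous polynomials of the same weight, and the denominator
does not vanish identically on `Z`. -/
def IsRegularOn (w : Var → ℤ × ℤ) (Z : Set (Variety w)) (f : CoxField) : Prop :=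
  ∃ (d : ℤ × ℤ) (p q : Cox), IsWeightedHomogeneous w p d ∧ IsWeightedHomogeneous w q d ∧
    (Z ∩ nonvanishing w q).Nonempty ∧ f = algebraMap Cox CoxField p / algebraMap Cox CoxField q

lemma ne_zero_of_nonvanishing {w : Var → ℤ × ℤ} {Z : Set (Variety w)} {q : Cox}
    (h : (Z ∩ nonvanishing w q).Nonempty) : algebraMap Cox CoxField q ≠ 0 := by
  obtain ⟨x, -, z, -, hz⟩ := h
  intro h0
  have : q = 0 := by
    apply IsFractionRing.injective Cox CoxField
    rw [h0, map_zero]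
  exact hz (by rw [this, map_zero])

lemma nonvanishing_mul {w : Var → ℤ × ℤ} {Z : Set (Variety w)} (hZ : IsIrreducible Z)
    {q q' : Cox} {d d' : ℤ × ℤ} (hq : IsWeightedHomogeneous w q d)
    (hq' : IsWeightedHomogeneous w q' d') (h : (Z ∩ nonvanishing w q).Nonempty)
    (h' : (Z ∩ nonvanishing w q').Nonempty) : (Z ∩ nonvanishing w (q * q')).Nonempty := by
  obtain ⟨x, hxZ, hx, hx'⟩ :=
    hZ.2 _ _ (isOpen_nonvanishing hq) (isOpen_nonvanishing hq') h h'
  obtain ⟨z, rfl, hz⟩ := hx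
  refine ⟨_, hxZ, z, rfl, ?_⟩
  rw [map_mul]
  exact mul_ne_zero hz ((quot_mem_nonvanishing hq' z).mp hx')

/-- The field of rational functions of the toric variety: fractions of homogeneous polynomials
of the same weight. -/
def functionField (w : Var → ℤ × ℤ) : IntermediateField ℂ CoxField where
  carrier := {f | ∃ (d : ℤ × ℤ) (p q : Cox), IsWeightedHomogeneous w p d ∧
    IsWeightedHomogeneous w q d ∧ q ≠ 0 ∧
    f = algebraMap Cox CoxField p / algebraMap Cox CoxField q}
  mul_mem' := by
    rintro _ _ ⟨d, p, q, hp, hq, h, rfl⟩ ⟨d', p', q', hp', hq', h', rfl⟩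
    exact ⟨d + d', p * p', q * q', hp.mul hp', hq.mul hq', mul_ne_zero h h', by
      rw [map_mul, map_mul, div_mul_div_comm]⟩
  add_mem' := by
    rintro _ _ ⟨d, p, q, hp, hq, h, rfl⟩ ⟨d', p', q', hp', hq', h', rfl⟩
    refine ⟨d + d', p * q' + q * p', q * q', (hp.mul hq').add (hq.mul hp'), hq.mul hq',
      mul_ne_zero h h', ?_⟩
    have hi : ∀ r : Cox, r ≠ 0 → algebraMap Cox CoxField r ≠ 0 := fun r hr =>
      (map_ne_zero_iff _ (IsFractionRing.injective Cox CoxField)).mpr hr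
    rw [div_add_div _ _ (hi q h) (hi q' h'), map_add, map_mul, map_mul, map_mul]
  algebraMap_mem' c := ⟨0, C c, 1, isWeightedHomogeneous_C w c, isWeightedHomogeneous_one ℂ w,
    one_ne_zero, by
      rw [map_one, div_one, IsScalarTower.algebraMap_apply ℂ Cox CoxField, algebraMap_eq]⟩
  inv_mem' := by
    rintro _ ⟨d, p, q, hp, hq, h, rfl⟩
    by_cases h0 : p = 0
    · exact ⟨d, p, q, hp, hq, h, by simp [h0]⟩
    · exact ⟨d, q, p, hq, hp, h0, by rw [inv_div]⟩

/-- The local ring of the toric variety along an irreducible subset `Z` (that is, at the generic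
point of the closure of `Z`). For `Z = {x}` this is the local ring at the point `x`. -/
def localRing (w : Var → ℤ × ℤ) (Z : Set (Variety w)) (hZ : IsIrreducible Z) :
    Subalgebra ℂ CoxField where
  carrier := {f | IsRegularOn w Z f}
  mul_mem' := by
    rintro _ _ ⟨d, p, q, hp, hq, h, rfl⟩ ⟨d', p', q', hp', hq', h', rfl⟩
    exact ⟨d + d', p * p', q * q', hp.mul hp', hq.mul hq', nonvanishing_mul hZ hq hq' h h', by
      rw [map_mul, map_mul, div_mul_div_comm]⟩
  add_mem' := by
    rintro _ _ ⟨d, p, q, hp, hq, h, rfl⟩ ⟨d', p', q', hp', hq', h', rfl⟩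
    refine ⟨d + d', p * q' + q * p', q * q', (hp.mul hq').add (hq.mul hp'), hq.mul hq',
      nonvanishing_mul hZ hq hq' h h', ?_⟩
    rw [div_add_div _ _ (ne_zero_of_nonvanishing h) (ne_zero_of_nonvanishing h'), map_add,
      map_mul, map_mul, map_mul]
  algebraMap_mem' c := by
    obtain ⟨x, hx⟩ := hZ.1
    obtain ⟨z, rfl⟩ : ∃ z, quot w z = x := Quotient.exists_rep x
    refine ⟨0, C c, 1, isWeightedHomogeneous_C w c, isWeightedHomogeneous_one ℂ w,
      ⟨_, hx, z, rfl, by simp⟩, ?_⟩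
    rw [map_one, div_one, IsScalarTower.algebraMap_apply ℂ Cox CoxField, algebraMap_eq]

instance (w : Var → ℤ × ℤ) (Z : Set (Variety w)) (hZ : IsIrreducible Z) :
    IsLocalRing (localRing w Z hZ) := by
  refine IsLocalRing.of_isUnit_or_isUnit_one_sub_self fun f => ?_
  obtain ⟨f, d, p, q, hp, hq, h, rfl⟩ := f
  have hunit : ∀ (p : Cox), IsWeightedHomogeneous w p d → (Z ∩ nonvanishing w p).Nonempty →
      ∀ g : localRing w Z hZ, g.1 = algebraMap Cox CoxField p / algebraMap Cox CoxField q →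
      IsUnit g := by
    intro p hp hpZ g hg
    refine IsUnit.of_mul_eq_one
      (⟨algebraMap Cox CoxField q / algebraMap Cox CoxField p, d, q, p, hq, hp, hpZ, rfl⟩ :
        localRing w Z hZ) (Subtype.ext ?_)
    change g.1 * _ = 1
    rw [hg, div_mul_div_comm, mul_comm]
    exact div_self (mul_ne_zero (ne_zero_of_nonvanishing h) (ne_zero_of_nonvanishing hpZ))
  by_cases hpZ : (Z ∩ nonvanishing w p).Nonempty
  · exact Or.inl (hunit p hp hpZ _ rfl)
  · right
    refine hunit (q - p) (hq.sub hp) ?_ _ ?_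
    · obtain ⟨x, hx, z, rfl, hz⟩ := h
      refine ⟨_, hx, z, rfl, ?_⟩
      have : eval z.1 p = 0 := by
        by_contra h0
        exact hpZ ⟨_, hx, z, rfl, h0⟩
      rwa [map_sub, this, sub_zero]
    · change 1 - _ = _
      rw [map_sub, sub_div, div_self (ne_zero_of_nonvanishing h)]

lemma localRing_mono {w : Var → ℤ × ℤ} {Y Z : Set (Variety w)} (hY : IsIrreducible Y)
    (hZ : IsIrreducible Z) (h : Y ⊆ Z) : localRing w Y hY ≤ localRing w Z hZ := by
  rintro f ⟨d, p, q, hp, hq, ⟨x, hx, hx'⟩, rfl⟩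
  exact ⟨d, p, q, hp, hq, ⟨x, h hx, hx'⟩, rfl⟩

/-- The order of an element `f` of a field with respect to a subring `A`, meant for `f ≠ 0` in the
fraction field of a discrete valuation ring `A`: the length of `A / (f)` if `f ∈ A`, and minus
the length of `A / (f⁻¹)` otherwise. -/
def orderAlong {K : Type*} [Field K] (A : Subring K) (f : K) : ℤ :=
  open Classical in
  if h : f ∈ A then ((Ring.ord A ⟨f, h⟩).toNat : ℤ)
  else if h : f⁻¹ ∈ A then -((Ring.ord A ⟨f⁻¹, h⟩).toNat : ℤ)
  else 0

/-- Prime divisors: irreducible closed subsets of codimension one. -/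
abbrev PrimeDivisor (w : Var → ℤ × ℤ) : Type :=
  {P : IrreducibleCloseds (Variety w) // Order.coheight P = 1}

/-- The order of vanishing of a rational function along a prime divisor. -/
def PrimeDivisor.ord {w : Var → ℤ × ℤ} (P : PrimeDivisor w) (f : CoxField) : ℤ :=
  orderAlong (localRing w (P.1 : Set (Variety w)) P.1.isIrreducible').toSubring f

/-- Weil divisors. The divisor `D` is effective if `0 ≤ D`. -/
abbrev WeilDivisor (w : Var → ℤ × ℤ) : Type := PrimeDivisor w →₀ ℤ

/-- Linear equivalence: `D - D'` is the divisor of a nonzero rational function. -/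
def LinearlyEquivalent {w : Var → ℤ × ℤ} (D D' : WeilDivisor w) : Prop :=
  ∃ f ∈ functionField w, f ≠ 0 ∧ ∀ P : PrimeDivisor w, D P - D' P = P.ord f

/-- The complete linear system `|D|`. -/
def linearSystem {w : Var → ℤ × ℤ} (D : WeilDivisor w) : Set (WeilDivisor w) :=
  {E | 0 ≤ E ∧ LinearlyEquivalent E D}

/-- `D` is mobile if for some `m > 0` the linear system `|mD|` is nonempty and has no fixed
component, i.e. no prime divisor occurs in all of its members. -/
def IsMobile {w : Var → ℤ × ℤ} (D : WeilDivisor w) : Prop :=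
  ∃ m : ℕ, 0 < m ∧ (linearSystem (m • D)).Nonempty ∧
    ∀ P : PrimeDivisor w, ∃ E ∈ linearSystem (m • D), E P = 0

/-- `g` is a local equation of `D` along `Z` (near the generic point of `Z`; for `Z = {x}`, near
the point `x`). -/
def IsLocalEquation {w : Var → ℤ × ℤ} (D : WeilDivisor w) (Z : Set (Variety w))
    (g : CoxField) : Prop :=
  g ∈ functionField w ∧ g ≠ 0 ∧
    ∀ P : PrimeDivisor w, Z ⊆ (P.1 : Set (Variety w)) → P.ord g = D P

/-- The field of rational functions of an irreducible closed subset `Z`. -/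
abbrev fieldOf {w : Var → ℤ × ℤ} (Z : IrreducibleCloseds (Variety w)) : Type :=
  IsLocalRing.ResidueField (localRing w (Z : Set (Variety w)) Z.isIrreducible')

/-- Curves in the toric variety: irreducible closed subsets of dimension one, i.e. whose field of
rational functions has transcendence degree one over `ℂ`. -/
abbrev Curve (w : Var → ℤ × ℤ) : Type :=
  {Z : IrreducibleCloseds (Variety w) // Algebra.trdeg ℂ (fieldOf Z) = 1}

/-- The points of the smooth projective model (the normalization) of the complete curve `C`: the
nontrivial valuation rings of its function field that contain `ℂ`. -/
abbrev Curve.Place {w : Var → ℤ × ℤ} (C : Curve w) : Type :=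
  {v : ValuationSubring (fieldOf C.1) // (∀ c : ℂ, algebraMap ℂ (fieldOf C.1) c ∈ v) ∧ v ≠ ⊤}

/-- The order of vanishing of a rational function of a curve at a point of its normalization. -/
def Curve.Place.ord {w : Var → ℤ × ℤ} {C : Curve w} (v : C.Place) (f : fieldOf C.1) : ℤ :=
  orderAlong v.1.toSubring f

/-- Restriction to the curve `C` of a function that is regular at a point `x` of `C`. -/
def Curve.restrict {w : Var → ℤ × ℤ} (C : Curve w) {x : Variety w}
    (hx : x ∈ (C.1 : Set (Variety w))) :
    localRing w {x} isIrreducible_singleton →ₐ[ℂ] fieldOf C.1 :=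
  (IsScalarTower.toAlgHom ℂ (localRing w (C.1 : Set (Variety w)) C.1.isIrreducible')
    (fieldOf C.1)).comp
      (Subalgebra.inclusion (localRing_mono _ _ (Set.singleton_subset_iff.mpr hx)))

/-- The point `v` of the normalization of `C` lies over the point `x` of `C`: the valuation ring of
`v` dominates the local ring of `C` at `x`. -/
def Curve.Place.LiesOver {w : Var → ℤ × ℤ} {C : Curve w} (v : C.Place) (x : Variety w) : Prop :=
  ∃ hx : x ∈ (C.1 : Set (Variety w)), ∀ f : localRing w {x} isIrreducible_singleton,
    C.restrict hx f ∈ v.1 ∧ (¬ IsUnit f → C.restrict hx f ∈ v.1.nonunits)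

/-- `q` is the intersection number `D · C`. Choose `m > 0` such that `mD` is Cartier, and a rational
function `h` such that `mD - div h` does not contain `C` in its support. Then `D · C` is `1 / m`
times the degree of the pull-back of `mD - div h` to the normalization of `C`: at a point `v` over
`x ∈ C`, its coefficient is the order at `v` of the restriction `r v` to `C` of the function
`g / h`, where `g` is a local equation of `mD` at `x`. -/
def IsIntersectionNumber {w : Var → ℤ × ℤ} (D : WeilDivisor w) (C : Curve w) (q : ℚ) : Prop :=
  ∃ (m : ℕ) (h : CoxField)
    (r : C.Place → localRing w (C.1 : Set (Variety w)) C.1.isIrreducible'),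
    0 < m ∧ IsLocalEquation (m • D) (C.1 : Set (Variety w)) h ∧
    (∀ v : C.Place, ∃ (x : Variety w) (g : CoxField), v.LiesOver x ∧
      IsLocalEquation (m • D) {x} g ∧ (r v : CoxField) = g / h) ∧
    (m : ℚ) * q = ((∑ᶠ v : C.Place, v.ord (IsLocalRing.residue _ (r v)) : ℤ) : ℚ)

open Classical in
/-- The intersection number `D · C ∈ ℚ`. -/
def intersectionNumber {w : Var → ℤ × ℤ} (D : WeilDivisor w) (C : Curve w) : ℚ :=
  if h : ∃ q, IsIntersectionNumber D C q then h.choose else 0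

/-- `D` is numerically trivial: `D · C = 0` for all curves `C`. -/
def NumericallyTrivial {w : Var → ℤ × ℤ} (D : WeilDivisor w) : Prop :=
  ∀ C : Curve w, intersectionNumber D C = 0

/-- A Weil divisor as a divisor with real coefficients. -/
def WeilDivisor.toReal {w : Var → ℤ × ℤ} (D : WeilDivisor w) : PrimeDivisor w →₀ ℝ :=
  D.mapRange (fun n : ℤ => (n : ℝ)) Int.cast_zero

/-- `N¹(𝓕)_ℝ`: divisors with real coefficients modulo the span of the numerically trivial ones. -/
def N1 (w : Var → ℤ × ℤ) : Type :=
  (PrimeDivisor w →₀ ℝ) ⧸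
    Submodule.span ℝ {D | ∃ E : WeilDivisor w, NumericallyTrivial E ∧ E.toReal = D}

instance (w : Var → ℤ × ℤ) : AddCommGroup (N1 w) := inferInstanceAs (AddCommGroup (_ ⧸ _))

instance (w : Var → ℤ × ℤ) : Module ℝ (N1 w) := inferInstanceAs (Module ℝ (_ ⧸ _))

/-- The usual topology of the finite dimensional real vector space `N¹(𝓕)_ℝ`. -/
instance (w : Var → ℤ × ℤ) : TopologicalSpace (N1 w) := moduleTopology ℝ (N1 w)

/-- The class of a Weil divisor in `N¹(𝓕)_ℝ`. -/
def WeilDivisor.numClass {w : Var → ℤ × ℤ} (D : WeilDivisor w) : N1 w :=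
  Submodule.Quotient.mk D.toReal

/-- The class of a prime divisor in `N¹(𝓕)_ℝ`. -/
def PrimeDivisor.numClass {w : Var → ℤ × ℤ} (P : PrimeDivisor w) : N1 w :=
  WeilDivisor.numClass (Finsupp.single P 1)

/-- The pseudo-effective cone: the closure of the cone generated by the classes of effective
divisors. -/
def pseudoEffectiveCone (w : Var → ℤ × ℤ) : Set (N1 w) :=
  closure (PointedCone.hull ℝ {c | ∃ D : WeilDivisor w, 0 ≤ D ∧ D.numClass = c} : Set (N1 w))

/-- The mobile cone: the cone generated by the classes of mobile divisors. -/
def mobileCone (w : Var → ℤ × ℤ) : Set (N1 w) :=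
  (PointedCone.hull ℝ {c | ∃ D : WeilDivisor w, IsMobile D ∧ D.numClass = c} : Set (N1 w))

/-- The locus where the Cox coordinate with index `j` vanishes. -/
def coordinateLocus (w : Var → ℤ × ℤ) (j : Var) : Set (Variety w) :=
  {x | ∃ z : CoxOpen, quot w z = x ∧ z.1 j = 0}

end RankTwoToric

end

/-!
Prime divisors of the toric variety `𝓕` correspond to irreducible homogeneous polynomials of the
Cox ring up to scalars: factors of homogeneous polynomials are homogeneous
(`isWeightedHomogeneous_of_dvd`), and the Nullstellensatz compares zero loci with divisibility
(`vanishing_subset_iff`, `PrimeDivisor.exists_eq_vanishing`). The order of a rational function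
`F / G` along the zero locus of `p` is the difference of the multiplicities of `p` in `F` and in
`G` (`PrimeDivisor.ord_div`). Its proof needs a uniformizer: `p` divided by a Laurent monomial of
the same weight in two coordinates prime to `p`, which exists because at least two of the `bⱼ`
are `1`.

Hence an equality of weights of two monomials gives a principal divisor, and principal divisors
are numerically trivial (`numericallyTrivial_of_principal`). Indeed, the local equations of the
divisor of `f` are `f` up to units, by normality (`mem_localRing_of_forall_ord_eq_zero`), so an
intersection number with a curve is the degree of the divisor of a rational function on the
normalization of that curve. This degree vanishes (`finsum_orderAlong_eq_zero`): the numbers of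
zeros and of poles of `t` are the degrees over `k(t)` and `k(t⁻¹)` of the function field, by the
fundamental identity `∑ e f = n` for the integral closure of `k[t]`. The function field is
finitely generated (`essFiniteType_fieldOf`), as all `bⱼ` divide `2`.

Consequently the class of the zero locus of `p` is the class of the divisor of any monomial
occurring in `p` (`vanishingDivisor_numClass_eq_sum`). The class of `x_l` is a nonnegative
combination of those of `u` and `x_n` whenever the ratio weight of `x_n` is the smaller one
(`coordinateDivisor_inr_mem_hull`). So every effective class lies in the cone of `D_u` and `D_4`,
which is closed, as is every cone with two generators (`PointedCone.isClosed_hull_pair`). A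
polynomial which defines a prime divisor other than `D_4` has a monomial without `x_4`; since a
multiple of a mobile divisor has an effective representative without `D_4`, its class lies in the
cone of `D_u` and `D_3`. Conversely `D_u` and `D_3` are mobile: `|D_u|` contains `D_u` and `D_v`,
and `|b_4 D_3|` contains `b_4 D_3` and `b_3 D_4 + c D_u` for some `c ≥ 0`.
-/

open RankTwoToric

/-! ### Homogeneous polynomials -/

/-- Every factor of a homogeneous polynomial is homogeneous: otherwise the extreme weights of the
two factors would produce two different weights in the product. -/
lemma isWeightedHomogeneous_of_dvd {σ R M : Type*} [CommSemiring R] [AddCommMonoid M]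
    [NoZeroDivisors (MvPolynomial σ R)] [TwoUniqueSums M] {w : σ → M} {p q : MvPolynomial σ R}
    {d : M} (hq : IsWeightedHomogeneous w q d) (hq0 : q ≠ 0) (hpq : p ∣ q) :
    ∃ e, IsWeightedHomogeneous w p e := by
  classical
  obtain ⟨r, rfl⟩ := hpq
  have hp0 : p ≠ 0 := left_ne_zero_of_mul hq0
  have hr0 : r ≠ 0 := right_ne_zero_of_mul hq0
  set A := p.support.image (Finsupp.weight w)
  set B := r.support.image (Finsupp.weight w)
  have hne : ∀ {s : MvPolynomial σ R} {x : M}, x ∈ s.support.image (Finsupp.weight w) →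
      weightedHomogeneousComponent w x s ≠ 0 := by
    intro s x hx h0
    obtain ⟨k, hk, rfl⟩ := Finset.mem_image.mp hx
    have := congrArg (coeff k) h0
    rw [coeff_weightedHomogeneousComponent, if_pos rfl, coeff_zero] at this
    exact mem_support_iff.mp hk this
  have hsum : ∀ s : MvPolynomial σ R, s = ∑ x ∈ s.support.image (Finsupp.weight w),
      weightedHomogeneousComponent w x s := by
    intro s
    ext k
    simp only [coeff_sum, coeff_weightedHomogeneousComponent]
    rw [Finset.sum_ite_eq]
    split_ifs with h
    · rfl
    · by_contra hk
      exact h (Finset.mem_image_of_mem _ (mem_support_iff.mpr hk))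
  have hom : ∀ x y, IsWeightedHomogeneous w (weightedHomogeneousComponent w x p *
      weightedHomogeneousComponent w y r) (x + y) := fun x y =>
    (weightedHomogeneousComponent_isWeightedHomogeneous x p).mul
      (weightedHomogeneousComponent_isWeightedHomogeneous y r)
  -- a weight with a unique decomposition survives in the product
  have key : ∀ x ∈ A, ∀ y ∈ B, UniqueAdd A B x y → x + y = d := by
    intro x hx y hy hxy
    by_contra hd
    have h1 : weightedHomogeneousComponent w (x + y) (p * r) = 0 :=
      hq.weightedHomogeneousComponent_ne _ hd
    have h2 : weightedHomogeneousComponent w (x + y) (p * r) =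
        weightedHomogeneousComponent w x p * weightedHomogeneousComponent w y r := by
      conv_lhs => rw [hsum p, hsum r, Finset.sum_mul_sum, map_sum]
      rw [Finset.sum_eq_single x]
      · rw [map_sum, Finset.sum_eq_single y]
        · exact (hom x y).weightedHomogeneousComponent_same
        · intro y' hy' hne'
          exact (hom x y').weightedHomogeneousComponent_ne _ fun h => hne' (hxy hx hy' h.symm).2
        · exact fun h => absurd hy h
      · intro x' hx' hne'
        rw [map_sum]
        refine Finset.sum_eq_zero fun y' hy' => ?_
        exact (hom x' y').weightedHomogeneousComponent_ne _ fun h => hne' (hxy hx' hy' h.symm).1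
      · exact fun h => absurd hx h
    exact mul_ne_zero (hne hx) (hne hy) (h2.symm.trans h1)
  have hA : A.Nonempty := (support_nonempty.mpr hp0).image _
  have hB : B.Nonempty := (support_nonempty.mpr hr0).image _
  by_cases hcard : 1 < A.card * B.card
  · exfalso
    obtain ⟨⟨x, y⟩, h1, ⟨x', y'⟩, h2, hne', hu, hu'⟩ :=
      TwoUniqueSums.uniqueAdd_of_one_lt_card hcard
    rw [Finset.mem_product] at h1 h2
    have e1 := key x h1.1 y h1.2 hu
    have e2 := key x' h2.1 y' h2.2 hu'
    obtain ⟨rfl, rfl⟩ := hu h2.1 h2.2 (e2.trans e1.symm)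
    exact hne' rfl
  · have hA1 : A.card ≤ 1 := by
      have := hB.card_pos
      nlinarith
    obtain ⟨x, hx⟩ := hA
    refine ⟨x, fun k hk => ?_⟩
    exact Finset.card_le_one.mp hA1 _
      (Finset.mem_image_of_mem _ (mem_support_iff.mpr hk)) _ hx

/-! ### The Zariski topology of the toric variety -/

lemma mem_coxOpen_iff {z : Var → ℂ} : z ∉ zeroLocus ℂ irrelevantIdeal ↔
    (∃ i : Fin 2, z (Sum.inl i) ≠ 0) ∧ ∃ j : Fin 4, z (Sum.inr j) ≠ 0 := by
  constructor
  · intro h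
    by_contra hcon
    apply h
    rw [mem_zeroLocus_iff]
    intro p hp
    rw [not_and_or, not_exists, not_exists] at hcon
    have hker : ∀ {n : ℕ} (f : Fin n → Var), (∀ i, ¬ z (f i) ≠ 0) →
        p ∈ Ideal.span (Set.range fun i => (X (f i) : Cox)) → aeval z p = 0 := by
      intro n f hf hpf
      have hle : Ideal.span (Set.range fun i => (X (f i) : Cox)) ≤
          RingHom.ker (aeval z : Cox →ₐ[ℂ] ℂ) := by
        rw [Ideal.span_le]
        rintro _ ⟨i, rfl⟩
        simpa [RingHom.mem_ker] using hf i
      exact hle hpf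
    rcases hcon with h' | h'
    · exact hker _ h' hp.1
    · exact hker _ h' hp.2
  · rintro ⟨⟨i, hi⟩, j, hj⟩ h
    have := h (X (Sum.inl i) * X (Sum.inr j))
      ⟨Ideal.mul_mem_right _ _ (Ideal.subset_span ⟨i, rfl⟩),
        Ideal.mul_mem_left _ _ (Ideal.subset_span ⟨j, rfl⟩)⟩
    simp [hi, hj] at this

lemma torusAct_mem {w : Var → ℤ × ℤ} (t : ℂˣ × ℂˣ) (z : CoxOpen) :
    torusAct w t z.1 ∉ zeroLocus ℂ irrelevantIdeal := by
  obtain ⟨⟨i, hi⟩, j, hj⟩ := mem_coxOpen_iff.mp z.2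
  exact mem_coxOpen_iff.mpr ⟨⟨i, mul_ne_zero (Units.ne_zero _) hi⟩,
    j, mul_ne_zero (Units.ne_zero _) hj⟩

lemma quot_torusAct {w : Var → ℤ × ℤ} (t : ℂˣ × ℂˣ) (z : CoxOpen) :
    quot w ⟨torusAct w t z.1, torusAct_mem t z⟩ = quot w z :=
  (Quotient.sound (⟨t, rfl⟩ : (orbitSetoid w).r z ⟨torusAct w t z.1, torusAct_mem t z⟩)).symm

lemma quot_surjective (w : Var → ℤ × ℤ) : Function.Surjective (quot w) := Quotient.exists_rep

/-- The character `torusChar d` as a monoid homomorphism to `ℂ`. -/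
noncomputable def torusCharHom (d : ℤ × ℤ) : ℂˣ × ℂˣ →* ℂ where
  toFun t := torusChar d t
  map_one' := by simp [torusChar_one]
  map_mul' s t := by simp [torusChar_mul]

lemma torusCharHom_injective : Function.Injective torusCharHom := by
  have h2 : ∀ m n : ℤ, (2 : ℂ) ^ m = 2 ^ n → m = n := by
    intro m n h
    have h' : (2 : ℝ) ^ m = 2 ^ n := by
      apply Complex.ofReal_injective
      push_cast
      exact h
    exact zpow_right_injective₀ (by norm_num) (by norm_num) h'
  intro d e h
  have h1 := DFunLike.congr_fun h (Units.mk0 2 two_ne_zero, 1)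
  have h1' := DFunLike.congr_fun h (1, Units.mk0 2 two_ne_zero)
  simp only [torusCharHom, torusChar, MonoidHom.coe_mk, OneHom.coe_mk, one_zpow, mul_one, one_mul,
    Units.val_zpow_eq_zpow_val, Units.val_mk0] at h1 h1'
  exact Prod.ext (h2 _ _ h1) (h2 _ _ h1')

/-- If `p` vanishes on a whole torus orbit, so do its homogeneous components, by the linear
independence of characters. -/
lemma eval_weightedHomogeneousComponent_eq_zero {w : Var → ℤ × ℤ} {p : Cox} {z : Var → ℂ}
    (h : ∀ t, eval (torusAct w t z) p = 0) (d : ℤ × ℤ) :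
    eval z (weightedHomogeneousComponent w d p) = 0 := by
  classical
  have hfin : (Function.support fun d => weightedHomogeneousComponent w d p).Finite :=
    weightedHomogeneousComponent_finsupp p
  have hli := (linearIndependent_monoidHom (ℂˣ × ℂˣ) ℂ).comp _ torusCharHom_injective
  rw [linearIndependent_iff'] at hli
  have hsum : ∑ e ∈ hfin.toFinset, eval z (weightedHomogeneousComponent w e p) •
      (((fun f : ℂˣ × ℂˣ →* ℂ => (f : ℂˣ × ℂˣ → ℂ)) ∘ torusCharHom) e) = 0 := by
    funext t
    have := h t
    rw [← finsum_weightedHomogeneousComponent w p, finsum_eq_sum _ hfin, map_sum] at this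
    rw [Finset.sum_apply, Pi.zero_apply, ← this]
    refine Finset.sum_congr rfl fun e _ => ?_
    rw [eval_torusAct (weightedHomogeneousComponent_isWeightedHomogeneous e p)]
    simp [torusCharHom, mul_comm]
  by_cases hd : d ∈ hfin.toFinset
  · exact hli _ _ hsum d hd
  · have : weightedHomogeneousComponent w d p = 0 := by simpa using hd
    rw [this, map_zero]

/-- The nonvanishing loci of homogeneous polynomials are a basis of the topology. -/
lemma exists_nonvanishing_subset {w : Var → ℤ × ℤ} {U : Set (Variety w)} (hU : IsOpen U)
    {x : Variety w} (hx : x ∈ U) :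
    ∃ (d : ℤ × ℤ) (q : Cox), IsWeightedHomogeneous w q d ∧ x ∈ nonvanishing w q ∧
      nonvanishing w q ⊆ U := by
  obtain ⟨V, hV, hVU⟩ := (@isOpen_induced_iff _ _ zariskiTopology _ _).mp (isOpen_coinduced.mp hU)
  obtain ⟨J, hJ⟩ : ∃ J : Ideal Cox, Vᶜ = zeroLocus ℂ J := hV
  have hmem : ∀ z : CoxOpen, quot w z ∈ U ↔ z.1 ∉ zeroLocus ℂ J := by
    intro z
    rw [← hJ, Set.notMem_compl_iff]
    exact (Set.ext_iff.mp hVU z).symm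
  obtain ⟨z, rfl⟩ := quot_surjective w x
  have hz := (hmem z).mp hx
  rw [mem_zeroLocus_iff] at hz
  push Not at hz
  obtain ⟨p, hpJ, hp⟩ := hz
  rw [aeval_eq_eval] at hp
  obtain ⟨d, hd⟩ : ∃ d, eval z.1 (weightedHomogeneousComponent w d p) ≠ 0 := by
    by_contra hcon
    push Not at hcon
    apply hp
    have hfin : (Function.support fun d => weightedHomogeneousComponent w d p).Finite :=
      weightedHomogeneousComponent_finsupp p
    change eval z.1 p = 0
    rw [← finsum_weightedHomogeneousComponent w p, finsum_eq_sum _ hfin, map_sum]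
    exact Finset.sum_eq_zero fun d _ => hcon d
  refine ⟨d, _, weightedHomogeneousComponent_isWeightedHomogeneous d p, ⟨z, rfl, hd⟩, ?_⟩
  rintro _ ⟨y, rfl, hy⟩
  by_contra hyU
  refine hy (eval_weightedHomogeneousComponent_eq_zero (fun t => ?_) d)
  rw [← quot_torusAct t y, hmem, not_not] at hyU
  have := hyU p hpJ
  rwa [aeval_eq_eval] at this

/-- For `p` irreducible, some product `uᵢ xⱼ` is prime to `p`, and `j` may be any index of a
prescribed set with two elements. -/
lemma exists_not_dvd_X {p : Cox} (hp : Irreducible p) {j₁ j₂ : Fin 4} (hj : j₁ ≠ j₂) :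
    ∃ i : Fin 2, ∃ j : Fin 4, (j = j₁ ∨ j = j₂) ∧ ¬ p ∣ X (Sum.inl i) ∧ ¬ p ∣ X (Sum.inr j) := by
  have key : ∀ k l : Var, k ≠ l → p ∣ X k → ¬ p ∣ X l := by
    intro k l hkl hk hl
    have hassoc := fun i (h : p ∣ X i) =>
      hp.associated_of_dvd (X_prime (R := ℂ) (i := i)).irreducible h
    exact hkl (X_dvd_X.mp ((hassoc k hk).symm.trans (hassoc l hl)).dvd)
  have h1 : ∃ i : Fin 2, ¬ p ∣ X (Sum.inl i) := by
    by_contra hcon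
    push Not at hcon
    exact key (Sum.inl 0) (Sum.inl 1) (by decide) (hcon 0) (hcon 1)
  obtain ⟨i, hi⟩ := h1
  by_cases h : p ∣ X (Sum.inr j₁)
  · exact ⟨i, j₂, Or.inr rfl, hi, key _ _ (by simpa using hj) h⟩
  · exact ⟨i, j₁, Or.inl rfl, hi, h⟩

/-- Nullstellensatz for hypersurfaces of `ℂ⁶ ∖ V(I)`. -/
lemma dvd_of_forall_coxOpen {p f : Cox} (hp : Irreducible p)
    (h : ∀ z : CoxOpen, eval z.1 p = 0 → eval z.1 f = 0) : p ∣ f := by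
  obtain ⟨i, j, -, hi, hj⟩ := exists_not_dvd_X hp (show (0 : Fin 4) ≠ 1 by decide)
  have hprime : Prime p := hp.prime
  have : (Ideal.span {p}).IsPrime := (Ideal.span_singleton_prime hp.ne_zero).mpr hprime
  have hmem : f * (X (Sum.inl i) * X (Sum.inr j)) ∈
      vanishingIdeal ℂ (zeroLocus ℂ (Ideal.span {p})) := by
    rw [mem_vanishingIdeal_iff]
    intro z hz
    have hz' : eval z p = 0 := by
      have := hz p (Ideal.mem_span_singleton_self p)
      rwa [aeval_eq_eval] at this
    rw [aeval_eq_eval]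
    change eval z _ = 0
    rw [map_mul, map_mul, eval_X, eval_X]
    by_cases h0 : z (Sum.inl i) * z (Sum.inr j) = 0
    · rw [h0, mul_zero]
    · rw [h ⟨z, mem_coxOpen_iff.mpr
        ⟨⟨i, left_ne_zero_of_mul h0⟩, j, right_ne_zero_of_mul h0⟩⟩ hz', zero_mul]
  rw [MvPolynomial.IsPrime.vanishingIdeal_zeroLocus, Ideal.mem_span_singleton] at hmem
  rcases hprime.dvd_or_dvd hmem with h | h
  · exact h
  · exact absurd (hprime.dvd_or_dvd h) (by tauto)

lemma eq_zero_of_forall_coxOpen {f : Cox} (h : ∀ z : CoxOpen, eval z.1 f = 0) : f = 0 := by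
  have : X (Sum.inl 0) * X (Sum.inr 0) * f = 0 := by
    refine MvPolynomial.funext fun z => ?_
    rw [map_mul, map_mul, eval_X, eval_X, map_zero]
    by_cases h0 : z (Sum.inl 0) * z (Sum.inr 0) = 0
    · rw [h0, zero_mul]
    · rw [h ⟨z, mem_coxOpen_iff.mpr
        ⟨⟨0, left_ne_zero_of_mul h0⟩, 0, right_ne_zero_of_mul h0⟩⟩, mul_zero]
  simpa using this

/-! ### Prime divisors and irreducible homogeneous polynomials -/

/-- The locus in the toric variety where a homogeneous polynomial vanishes. -/
def vanishing (w : Var → ℤ × ℤ) (p : Cox) : Set (Variety w) := (nonvanishing w p)ᶜ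

lemma quot_mem_vanishing {w : Var → ℤ × ℤ} {p : Cox} {d : ℤ × ℤ}
    (hp : IsWeightedHomogeneous w p d) (z : CoxOpen) :
    quot w z ∈ vanishing w p ↔ eval z.1 p = 0 := by
  rw [vanishing, Set.mem_compl_iff, quot_mem_nonvanishing hp, not_not]

lemma isClosed_vanishing {w : Var → ℤ × ℤ} {p : Cox} {d : ℤ × ℤ}
    (hp : IsWeightedHomogeneous w p d) : IsClosed (vanishing w p) :=
  (isOpen_nonvanishing hp).isClosed_compl

lemma vanishing_subset_iff {w : Var → ℤ × ℤ} {p q : Cox} {d e : ℤ × ℤ}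
    (hp : IsWeightedHomogeneous w p d) (hq : IsWeightedHomogeneous w q e) (hirr : Irreducible p) :
    vanishing w p ⊆ vanishing w q ↔ p ∣ q := by
  constructor
  · exact fun h => dvd_of_forall_coxOpen hirr fun z hz =>
      (quot_mem_vanishing hq z).mp (h ((quot_mem_vanishing hp z).mpr hz))
  · rintro ⟨r, rfl⟩ x hx
    obtain ⟨z, rfl⟩ := quot_surjective w x
    rw [quot_mem_vanishing hp] at hx
    rw [quot_mem_vanishing hq, map_mul, hx, zero_mul]

lemma not_isUnit_of_vanishing {w : Var → ℤ × ℤ} {Z : Set (Variety w)} (hne : Z.Nonempty) {q : Cox}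
    (h : Z ⊆ vanishing w q) : ¬ IsUnit q := by
  rintro ⟨c, rfl⟩
  obtain ⟨x, hx⟩ := hne
  obtain ⟨z, rfl⟩ := quot_surjective w x
  exact h hx ⟨z, rfl, (c.isUnit.map (eval z.1)).ne_zero⟩

lemma vanishing_nonempty {w : Var → ℤ × ℤ} {p : Cox} {d : ℤ × ℤ}
    (hp : IsWeightedHomogeneous w p d) (hirr : Irreducible p) : (vanishing w p).Nonempty := by
  by_contra h
  rw [Set.not_nonempty_iff_eq_empty] at h
  refine hirr.not_isUnit (isUnit_of_dvd_one ((vanishing_subset_iff hp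
    (isWeightedHomogeneous_one ℂ w) hirr).mp ?_))
  rw [h]
  exact Set.empty_subset _

lemma isIrreducible_vanishing {w : Var → ℤ × ℤ} {p : Cox} {d : ℤ × ℤ}
    (hp : IsWeightedHomogeneous w p d) (hirr : Irreducible p) : IsIrreducible (vanishing w p) := by
  refine ⟨vanishing_nonempty hp hirr, ?_⟩
  rintro U V hU hV ⟨x, hxp, hxU⟩ ⟨y, hyp, hyV⟩
  obtain ⟨d₁, f, hf, hxf, hfU⟩ := exists_nonvanishing_subset hU hxU
  obtain ⟨d₂, g, hg, hyg, hgV⟩ := exists_nonvanishing_subset hV hyV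
  have h1 : ¬ p ∣ f := fun h => (vanishing_subset_iff hp hf hirr).mpr h hxp hxf
  have h2 : ¬ p ∣ g := fun h => (vanishing_subset_iff hp hg hirr).mpr h hyp hyg
  have h3 : ¬ p ∣ f * g := fun h => (hirr.prime.dvd_or_dvd h).elim h1 h2
  rw [← vanishing_subset_iff hp (hf.mul hg) hirr, Set.not_subset] at h3
  obtain ⟨z, hz, hzfg⟩ := h3
  obtain ⟨z, rfl⟩ := quot_surjective w z
  rw [quot_mem_vanishing (hf.mul hg), map_mul] at hzfg
  exact ⟨_, hz, hfU ⟨z, rfl, left_ne_zero_of_mul hzfg⟩, hgV ⟨z, rfl, right_ne_zero_of_mul hzfg⟩⟩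

instance (w : Var → ℤ × ℤ) : IrreducibleSpace (Variety w) where
  toNonempty := ⟨quot w ⟨1, mem_coxOpen_iff.mpr ⟨⟨0, one_ne_zero⟩, 0, one_ne_zero⟩⟩⟩
  isPreirreducible_univ := by
    rintro U V hU hV ⟨x, -, hxU⟩ ⟨y, -, hyV⟩
    obtain ⟨d₁, f, hf, ⟨z, -, hz⟩, hfU⟩ := exists_nonvanishing_subset hU hxU
    obtain ⟨d₂, g, hg, ⟨z', -, hz'⟩, hgV⟩ := exists_nonvanishing_subset hV hyV
    have hfg : f * g ≠ 0 := mul_ne_zero (by rintro rfl; simp at hz) (by rintro rfl; simp at hz')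
    obtain ⟨y, hy⟩ : ∃ y : CoxOpen, eval y.1 (f * g) ≠ 0 := by
      by_contra hcon
      push Not at hcon
      exact hfg (eq_zero_of_forall_coxOpen hcon)
    rw [map_mul] at hy
    exact ⟨_, trivial, hfU ⟨y, rfl, left_ne_zero_of_mul hy⟩, hgV ⟨y, rfl, right_ne_zero_of_mul hy⟩⟩

instance (w : Var → ℤ × ℤ) : OrderTop (IrreducibleCloseds (Variety w)) where
  top := ⟨Set.univ, IrreducibleSpace.isIrreducible_univ _, isClosed_univ⟩
  le_top _ := Set.subset_univ _

/-- An irreducible subset contained in the zero locus of a nonzero homogeneous polynomial is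
contained in that of one of its irreducible factors. -/
lemma exists_irreducible_factor {w : Var → ℤ × ℤ} {Z : Set (Variety w)} (hZ : IsIrreducible Z)
    {q : Cox} {d : ℤ × ℤ} (hq : IsWeightedHomogeneous w q d) (hq0 : q ≠ 0)
    (hqZ : Z ⊆ vanishing w q) :
    ∃ (e : ℤ × ℤ) (p : Cox), IsWeightedHomogeneous w p e ∧ Irreducible p ∧ p ∣ q ∧
      Z ⊆ vanishing w p := by
  induction q using WfDvdMonoid.induction_on_irreducible generalizing d with
  | zero => exact absurd rfl hq0
  | unit u hu => exact absurd hu (not_isUnit_of_vanishing hZ.1 hqZ)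
  | mul r p hr hp ih =>
    obtain ⟨e, he⟩ := isWeightedHomogeneous_of_dvd hq hq0 (dvd_mul_right p r)
    obtain ⟨e', he'⟩ := isWeightedHomogeneous_of_dvd hq hq0 (dvd_mul_left r p)
    by_cases h : Z ⊆ vanishing w p
    · exact ⟨e, p, he, hp, dvd_mul_right p r, h⟩
    by_cases h' : Z ⊆ vanishing w r
    · obtain ⟨e'', s, hs, hs', hsr, hsZ⟩ := ih he' hr h'
      exact ⟨e'', s, hs, hs', hsr.mul_left p, hsZ⟩
    · exfalso
      have hne : ∀ {s : Cox}, ¬ Z ⊆ vanishing w s → (Z ∩ nonvanishing w s).Nonempty := by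
        intro s hs
        obtain ⟨x, hx, hxs⟩ := Set.not_subset.mp hs
        exact ⟨x, hx, not_not.mp hxs⟩
      obtain ⟨x, hx, hx'⟩ := nonvanishing_mul hZ he he' (hne h) (hne h')
      exact hqZ hx hx'

/-- A proper irreducible closed subset lies in the zero locus of an irreducible homogeneous
polynomial. -/
lemma exists_subset_vanishing {w : Var → ℤ × ℤ} {Z : IrreducibleCloseds (Variety w)} (hZ : Z ≠ ⊤) :
    ∃ (e : ℤ × ℤ) (p : Cox), IsWeightedHomogeneous w p e ∧ Irreducible p ∧
      (Z : Set (Variety w)) ⊆ vanishing w p := by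
  have hne : (Z : Set (Variety w))ᶜ.Nonempty := by
    rw [Set.nonempty_compl]
    exact fun h => hZ (IrreducibleCloseds.ext h)
  obtain ⟨x, hx⟩ := hne
  obtain ⟨d, q, hq, ⟨z, -, hz⟩, hqZ⟩ := exists_nonvanishing_subset Z.isClosed'.isOpen_compl hx
  obtain ⟨e, p, hp, hirr, -, hpZ⟩ := exists_irreducible_factor Z.isIrreducible' hq
    (by rintro rfl; simp at hz) (fun y hy hyq => hqZ hyq hy)
  exact ⟨e, p, hp, hirr, hpZ⟩

lemma coheight_eq_one_iff_covBy_top {α : Type*} [PartialOrder α] [OrderTop α] {x : α} :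
    Order.coheight x = 1 ↔ x ⋖ ⊤ := by
  constructor
  · intro h
    have hx : x ≠ ⊤ := by
      rintro rfl
      simp at h
    refine ⟨hx.lt_top, fun c hxc hc => hc.ne ?_⟩
    have h1 := Order.coheight_add_one_le hxc
    rw [h] at h1
    have h2 : Order.coheight c = 0 := by
      by_contra h0
      have h3 : (1 : ℕ∞) ≤ Order.coheight c := Order.one_le_iff_ne_zero.mpr h0
      have h4 : (1 : ℕ∞) + 1 ≤ 1 := (add_le_add_left h3 1).trans h1
      exact absurd h4 (by decide)
    exact (Order.coheight_eq_zero.mp h2).eq_top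
  · intro h
    refine le_antisymm (Order.coheight_le_coe_iff.mpr fun y hy => ?_)
      (Order.one_le_iff_ne_zero.mpr fun h0 => h.lt.ne (Order.coheight_eq_zero.mp h0).eq_top)
    have : y = ⊤ := by
      by_contra hy'
      exact h.2 hy (Ne.lt_top hy')
    simp [this]

/-- The irreducible closed subset cut out by an irreducible homogeneous polynomial. -/
def vanishingCloseds {w : Var → ℤ × ℤ} {p : Cox} {d : ℤ × ℤ}
    (hp : IsWeightedHomogeneous w p d) (hirr : Irreducible p) : IrreducibleCloseds (Variety w) :=
  ⟨vanishing w p, isIrreducible_vanishing hp hirr, isClosed_vanishing hp⟩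

lemma vanishingCloseds_ne_top {w : Var → ℤ × ℤ} {p : Cox} {d : ℤ × ℤ}
    (hp : IsWeightedHomogeneous w p d) (hirr : Irreducible p) : vanishingCloseds hp hirr ≠ ⊤ := by
  intro h
  refine hirr.ne_zero (eq_zero_of_forall_coxOpen fun z => (quot_mem_vanishing hp z).mp ?_)
  have : quot w z ∈ ((⊤ : IrreducibleCloseds (Variety w)) : Set (Variety w)) := trivial
  rwa [← h] at this

/-- Only the whole variety lies strictly above the zero locus of an irreducible polynomial, because
such polynomials do not divide one another. -/
lemma coheight_vanishingCloseds {w : Var → ℤ × ℤ} {p : Cox} {d : ℤ × ℤ}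
    (hp : IsWeightedHomogeneous w p d) (hirr : Irreducible p) :
    Order.coheight (vanishingCloseds hp hirr) = 1 := by
  have hcov : vanishingCloseds hp hirr ⋖ ⊤ := by
    refine ⟨lt_top_iff_ne_top.mpr (vanishingCloseds_ne_top hp hirr), fun Q hQ hQtop => ?_⟩
    obtain ⟨e, q, hq, hqirr, hQq⟩ := exists_subset_vanishing hQtop.ne
    have hpq : p ∣ q := (vanishing_subset_iff hp hq hirr).mp fun x hx => hQq (hQ.le hx)
    have hqp : q ∣ p := (hirr.associated_of_dvd hqirr hpq).symm.dvd
    exact hQ.not_ge fun x hx => (vanishing_subset_iff hq hp hqirr).mpr hqp (hQq hx)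
  exact coheight_eq_one_iff_covBy_top.mpr hcov

/-- The prime divisor cut out by an irreducible homogeneous polynomial. -/
def vanishingDivisor {w : Var → ℤ × ℤ} {p : Cox} {d : ℤ × ℤ}
    (hp : IsWeightedHomogeneous w p d) (hirr : Irreducible p) : PrimeDivisor w :=
  ⟨vanishingCloseds hp hirr, coheight_vanishingCloseds hp hirr⟩

/-- Every prime divisor is cut out by an irreducible homogeneous polynomial. -/
lemma PrimeDivisor.exists_eq_vanishing {w : Var → ℤ × ℤ} (P : PrimeDivisor w) :
    ∃ (p : Cox) (d : ℤ × ℤ), IsWeightedHomogeneous w p d ∧ Irreducible p ∧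
      (P.1 : Set (Variety w)) = vanishing w p := by
  have hcov : P.1 ⋖ ⊤ := coheight_eq_one_iff_covBy_top.mp P.2
  obtain ⟨e, p, hp, hirr, hPp⟩ := exists_subset_vanishing hcov.lt.ne
  refine ⟨p, e, hp, hirr, ?_⟩
  have := hcov.eq_or_eq (c := vanishingCloseds hp hirr) hPp le_top
  rcases this with h | h
  · rw [← h]
    rfl
  · exact absurd h (vanishingCloseds_ne_top hp hirr)

/-! ### Orders of vanishing -/

/-- If `π` generates the maximal ideal of the local ring `A`, the order of `π ^ n` times a unit
is `n`. -/
lemma orderAlong_zpow_mul {K : Type*} [Field K] {A : Subring K} {π : K} (hπ : π ∈ A)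
    (hπ0 : π ≠ 0) (hπ' : π⁻¹ ∉ A) (hmax : ∀ f ∈ A, f⁻¹ ∉ A → f / π ∈ A) {u : K} (hu0 : u ≠ 0)
    (hu : u ∈ A) (hu' : u⁻¹ ∈ A) (n : ℤ) : orderAlong A (π ^ n * u) = n := by
  have hunit : ∀ (x : A), (x : K) ≠ 0 → (x : K)⁻¹ ∈ A → IsUnit x := fun x hx hx' =>
    IsUnit.of_mul_eq_one ⟨_, hx'⟩ (Subtype.ext (mul_inv_cancel₀ hx))
  have hunit' : ∀ (x : A), IsUnit x → (x : K)⁻¹ ∈ A := by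
    rintro _ ⟨x, rfl⟩
    have : ((x : A) : K)⁻¹ = ((x⁻¹ : Aˣ) : A) := by
      apply inv_eq_of_mul_eq_one_right
      exact congrArg Subtype.val x.mul_inv
    rw [this]
    exact Subtype.mem _
  set ϖ : A := ⟨π, hπ⟩
  have hϖ : ϖ ∈ nonZeroDivisors A :=
    mem_nonZeroDivisors_of_ne_zero fun h => hπ0 (congrArg Subtype.val h)
  have hM : (Ideal.span {ϖ}).IsMaximal := by
    refine Ideal.isMaximal_iff.mpr ⟨fun h => ?_, fun J x hJ hx hxJ => ?_⟩
    · rw [Ideal.mem_span_singleton] at h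
      exact hπ' (hunit' _ (isUnit_of_dvd_one h))
    · by_cases hx' : (x : K)⁻¹ ∈ A
      · have hx0 : (x : K) ≠ 0 := by
          rintro h0
          exact hx (by rw [show x = 0 from Subtype.ext h0]; exact zero_mem _)
        exact (Ideal.eq_top_iff_one J).mp (Ideal.eq_top_of_isUnit_mem J hxJ (hunit x hx0 hx'))
      · refine absurd ?_ hx
        rw [Ideal.mem_span_singleton]
        refine ⟨⟨_, hmax x x.2 hx'⟩, Subtype.ext ?_⟩
        change (x : K) = π * (x / π)
        field_simp
  have hord1 : Ring.ord A ϖ = 1 := by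
    rw [Ring.ord, Module.length_eq_one_iff, isSimpleModule_iff_isCoatom]
    exact Ideal.isMaximal_def.mp hM
  have hnat : ∀ (n : ℕ) (u : K) (hu0 : u ≠ 0) (hu : u ∈ A) (hu' : u⁻¹ ∈ A) (x : A),
      (x : K) = π ^ n * u → Ring.ord A x = n := by
    intro n u hu0 hu hu' x hx
    have : x = ϖ ^ n * ⟨u, hu⟩ := Subtype.ext hx
    have hu1 : IsUnit (⟨u, hu⟩ : A) := hunit _ hu0 hu'
    rw [this, Ring.ord_mul_of_isUnit_right hu1, Ring.ord_pow hϖ, hord1]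
    simp
  unfold orderAlong
  obtain ⟨n, rfl | rfl⟩ := n.eq_nat_or_neg
  · have hmem : π ^ (n : ℤ) * u ∈ A := by
      rw [zpow_natCast]
      exact mul_mem (pow_mem hπ n) hu
    rw [dif_pos hmem, hnat n u hu0 hu hu' _ (congrArg (· * u) (zpow_natCast π n))]
    simp
  · by_cases hn : n = 0
    · subst hn
      have hmem : π ^ (-((0 : ℕ) : ℤ)) * u ∈ A := by simpa using hu
      rw [dif_pos hmem, hnat 0 u hu0 hu hu' _ (by simp)]
      simp
    · have hinv : (π ^ (-(n : ℤ)) * u)⁻¹ = π ^ n * u⁻¹ := by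
        rw [mul_inv, zpow_neg, inv_inv, zpow_natCast]
      have hmem : (π ^ (-(n : ℤ)) * u)⁻¹ ∈ A := by
        rw [hinv]
        exact mul_mem (pow_mem hπ n) hu'
      have hnot : π ^ (-(n : ℤ)) * u ∉ A := by
        intro h
        obtain ⟨k, rfl⟩ := Nat.exists_eq_succ_of_ne_zero hn
        apply hπ'
        have : π⁻¹ = π ^ (-((k + 1 : ℕ) : ℤ)) * u * u⁻¹ * π ^ k := by
          rw [zpow_neg, zpow_natCast]
          field_simp
          rw [pow_succ']
        rw [this]
        exact mul_mem (mul_mem h hu') (pow_mem hπ k)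
      rw [dif_neg hnot, dif_pos hmem, hnat n u⁻¹ (inv_ne_zero hu0) hu' (by rwa [inv_inv]) _ hinv]
      simp

lemma orderAlong_unit_mul {K : Type*} [Field K] {A : Subring K} {u : K} (hu0 : u ≠ 0)
    (hu : u ∈ A) (hu' : u⁻¹ ∈ A) (x : K) : orderAlong A (u * x) = orderAlong A x := by
  have hmem : ∀ {u : K}, u ≠ 0 → u ∈ A → u⁻¹ ∈ A → ∀ x, u * x ∈ A ↔ x ∈ A := by
    intro u hu0 hu hu' x
    refine ⟨fun h => ?_, fun h => mul_mem hu h⟩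
    have := mul_mem hu' h
    rwa [inv_mul_cancel_left₀ hu0] at this
  have hord : ∀ {u : K} (hu0 : u ≠ 0) (hu : u ∈ A) (hu' : u⁻¹ ∈ A) (x y : A), (y : K) = u * x →
      Ring.ord A y = Ring.ord A x := by
    intro u hu0 hu hu' x y hy
    have h1 : IsUnit (⟨u, hu⟩ : A) :=
      IsUnit.of_mul_eq_one ⟨_, hu'⟩ (Subtype.ext (mul_inv_cancel₀ hu0))
    rw [show y = ⟨u, hu⟩ * x from Subtype.ext hy, Ring.ord_mul_of_isUnit_left h1]
  have hu0' := inv_ne_zero hu0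
  have hu'' : u⁻¹⁻¹ ∈ A := by rwa [inv_inv]
  unfold orderAlong
  by_cases h1 : x ∈ A
  · rw [dif_pos h1, dif_pos ((hmem hu0 hu hu' x).mpr h1), hord hu0 hu hu' ⟨x, h1⟩ _ rfl]
  · rw [dif_neg h1, dif_neg (mt (hmem hu0 hu hu' x).mp h1)]
    have hiff : (u * x)⁻¹ ∈ A ↔ x⁻¹ ∈ A := by
      rw [mul_inv]
      exact hmem hu0' hu' hu'' _
    by_cases h2 : x⁻¹ ∈ A
    · rw [dif_pos h2, dif_pos (hiff.mpr h2), hord hu0' hu' hu'' ⟨_, h2⟩ _ (mul_inv u x)]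
    · rw [dif_neg h2, dif_neg (mt hiff.mp h2)]

lemma orderAlong_unit {K : Type*} [Field K] {A : Subring K} {u : K} (hu0 : u ≠ 0)
    (hu : u ∈ A) (hu' : u⁻¹ ∈ A) : orderAlong A u = 0 := by
  have h := orderAlong_unit_mul hu0 hu hu' 1
  rw [mul_one] at h
  rw [h, orderAlong, dif_pos A.one_mem]
  have : Ring.ord A ⟨1, A.one_mem⟩ = 0 := Ring.ord_of_isUnit isUnit_one
  rw [this]
  rfl

lemma algebraMap_ne_zero {p : Cox} (hp : p ≠ 0) : algebraMap Cox CoxField p ≠ 0 :=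
  (map_ne_zero_iff _ (IsFractionRing.injective Cox CoxField)).mpr hp

lemma algebraMap_X_ne_zero (l : Var) : algebraMap Cox CoxField (X l) ≠ 0 :=
  algebraMap_ne_zero (X_ne_zero l)

/-- The Laurent monomial in `uᵢ` and `xⱼ` of weight `d`. It exists if `b j` divides the second
component of `d`; otherwise the value has no meaning. -/
noncomputable def laurent (a b : Fin 4 → ℕ) (i : Fin 2) (j : Fin 4) (d : ℤ × ℤ) : CoxField :=
  algebraMap Cox CoxField (X (Sum.inl i)) ^ (d.1 + a j * (d.2 / b j)) *
    algebraMap Cox CoxField (X (Sum.inr j)) ^ (d.2 / b j)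

lemma laurent_ne_zero (a b : Fin 4 → ℕ) (i : Fin 2) (j : Fin 4) (d : ℤ × ℤ) :
    laurent a b i j d ≠ 0 :=
  mul_ne_zero (zpow_ne_zero _ (algebraMap_X_ne_zero _)) (zpow_ne_zero _ (algebraMap_X_ne_zero _))

lemma laurent_add (a b : Fin 4 → ℕ) (i : Fin 2) (j : Fin 4) {d e : ℤ × ℤ}
    (hd : (b j : ℤ) ∣ d.2) :
    laurent a b i j (d + e) = laurent a b i j d * laurent a b i j e := by
  unfold laurent
  rw [Prod.snd_add, Prod.fst_add, Int.add_ediv_of_dvd_left hd,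
    show d.1 + e.1 + a j * (d.2 / b j + e.2 / b j) =
      (d.1 + a j * (d.2 / b j)) + (e.1 + a j * (e.2 / b j)) by ring,
    zpow_add₀ (algebraMap_X_ne_zero (Sum.inl i)), zpow_add₀ (algebraMap_X_ne_zero (Sum.inr j))]
  ring

/-- The Laurent monomial of weight `d` as a fraction of monomials. -/
lemma exists_laurent_eq_div {a b : Fin 4 → ℕ} (i : Fin 2) {j : Fin 4} (hbj : b j ≠ 0) {d : ℤ × ℤ}
    (hd : (b j : ℤ) ∣ d.2) :
    ∃ N ∈ Submonoid.closure {(X (Sum.inl i) : Cox), X (Sum.inr j)},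
      ∃ D ∈ Submonoid.closure {(X (Sum.inl i) : Cox), X (Sum.inr j)}, ∃ e : ℤ × ℤ,
        IsWeightedHomogeneous (weights a b) N (d + e) ∧
          IsWeightedHomogeneous (weights a b) D e ∧
          laurent a b i j d = algebraMap Cox CoxField N / algebraMap Cox CoxField D := by
  obtain ⟨c, hc⟩ := hd
  have hmem : ∀ m n : ℕ, (X (Sum.inl i) ^ m * X (Sum.inr j) ^ n : Cox) ∈
      Submonoid.closure {(X (Sum.inl i) : Cox), X (Sum.inr j)} := fun m n =>
    mul_mem (pow_mem (Submonoid.subset_closure (by simp)) m)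
      (pow_mem (Submonoid.subset_closure (by simp)) n)
  have hhom : ∀ m n : ℕ, IsWeightedHomogeneous (weights a b)
      (X (Sum.inl i) ^ m * X (Sum.inr j) ^ n : Cox)
        (m • weights a b (Sum.inl i) + n • weights a b (Sum.inr j)) := fun m n =>
    ((isWeightedHomogeneous_X ℂ _ _).pow m).mul ((isWeightedHomogeneous_X ℂ _ _).pow n)
  have hc' : d.2 / b j = c := by
    rw [hc, Int.mul_ediv_cancel_left _ (by exact_mod_cast hbj)]
  set c' : ℤ := d.1 + a j * c with hc'_def
  have h1 : (c'.toNat : ℤ) - ((-c').toNat : ℤ) = c' := by omega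
  have h2 : (c.toNat : ℤ) - ((-c).toNat : ℤ) = c := by omega
  refine ⟨_, hmem c'.toNat c.toNat, _, hmem (-c').toNat (-c).toNat, _, ?_, hhom _ _, ?_⟩
  · convert! hhom c'.toNat c.toNat using 1
    rw [hc'_def] at h1
    ext
    · simp only [weights, Prod.fst_add, Prod.smul_mk, nsmul_eq_mul, mul_one]
      linear_combination -h1 + a j * h2
    · simp only [weights, Prod.snd_add, Prod.smul_mk, nsmul_eq_mul, mul_zero, zero_add]
      linear_combination hc - b j * h2
  · rw [laurent, hc', ← hc'_def]
    conv_lhs => rw [← h1, ← h2, zpow_sub₀ (algebraMap_X_ne_zero _),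
      zpow_sub₀ (algebraMap_X_ne_zero _)]
    simp only [zpow_natCast, map_mul, map_pow]
    rw [div_mul_div_comm]

lemma not_dvd_of_mem_closure {i : Fin 2} {j : Fin 4} {p : Cox} (hp : Irreducible p)
    (hi : ¬ p ∣ X (Sum.inl i)) (hj : ¬ p ∣ X (Sum.inr j)) {N : Cox}
    (hN : N ∈ Submonoid.closure {(X (Sum.inl i) : Cox), X (Sum.inr j)}) : ¬ p ∣ N := by
  induction hN using Submonoid.closure_induction with
  | mem x hx =>
    rcases hx with rfl | rfl
    · exact hi
    · exact hj
  | one => exact fun h => hp.not_isUnit (isUnit_of_dvd_one h)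
  | mul x y _ _ hx hy => exact fun h => (hp.prime.dvd_or_dvd h).elim hx hy

lemma div_mem_localRing {w : Var → ℤ × ℤ} {Z : Set (Variety w)} (hZ : IsIrreducible Z)
    {F G : Cox} {d : ℤ × ℤ} (hF : IsWeightedHomogeneous w F d) (hG : IsWeightedHomogeneous w G d)
    (h : ¬ Z ⊆ vanishing w G) :
    algebraMap Cox CoxField F / algebraMap Cox CoxField G ∈ localRing w Z hZ := by
  obtain ⟨x, hx, hxG⟩ := Set.not_subset.mp h
  exact ⟨d, F, G, hF, hG, ⟨x, hx, not_not.mp hxG⟩, rfl⟩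

lemma exists_eq_div_of_mem_localRing {w : Var → ℤ × ℤ} {Z : Set (Variety w)}
    (hZ : IsIrreducible Z) {f : CoxField} (hf : f ∈ localRing w Z hZ) :
    ∃ (d : ℤ × ℤ) (F G : Cox), IsWeightedHomogeneous w F d ∧ IsWeightedHomogeneous w G d ∧
      ¬ Z ⊆ vanishing w G ∧ f = algebraMap Cox CoxField F / algebraMap Cox CoxField G := by
  obtain ⟨d, F, G, hF, hG, ⟨x, hx, hxG⟩, rfl⟩ := hf
  exact ⟨d, F, G, hF, hG, fun h => h hx hxG, rfl⟩

/-- The order of a rational function along the zero locus of `p` is the multiplicity of `p` in the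
numerator minus that in the denominator. A uniformizer is `p` divided by a Laurent monomial of
the same weight in two Cox coordinates prime to `p`. -/
theorem PrimeDivisor.ord_div {a b : Fin 4 → ℕ} {j₁ j₂ : Fin 4} (hj : j₁ ≠ j₂) (h₁ : b j₁ = 1)
    (h₂ : b j₂ = 1) (P : PrimeDivisor (weights a b)) {p : Cox} {d : ℤ × ℤ}
    (hp : IsWeightedHomogeneous (weights a b) p d) (hirr : Irreducible p)
    (hP : (P.1 : Set (Variety (weights a b))) = vanishing (weights a b) p) {F G : Cox}
    {f : ℤ × ℤ} (hF : IsWeightedHomogeneous (weights a b) F f)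
    (hG : IsWeightedHomogeneous (weights a b) G f) (hF0 : F ≠ 0) (hG0 : G ≠ 0) :
    P.ord (algebraMap Cox CoxField F / algebraMap Cox CoxField G) =
      (multiplicity p F : ℤ) - multiplicity p G := by
  obtain ⟨i, j, hj', hi, hpj⟩ := exists_not_dvd_X hirr hj
  have hbj : b j = 1 := by rcases hj' with rfl | rfl <;> assumption
  obtain ⟨N, hNmem, D, hDmem, e, hN, hD, -⟩ :=
    exists_laurent_eq_div i (d := d) (show b j ≠ 0 by omega) (by rw [hbj]; exact one_dvd _)
  have hpN := not_dvd_of_mem_closure hirr hi hpj hNmem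
  have hpD := not_dvd_of_mem_closure hirr hi hpj hDmem
  have ne0 : ∀ {q : Cox}, ¬ p ∣ q → q ≠ 0 := by
    rintro q hq rfl
    exact hq (dvd_zero p)
  have hdvd : ∀ {q : Cox} {e : ℤ × ℤ}, IsWeightedHomogeneous (weights a b) q e →
      ((P.1 : Set (Variety (weights a b))) ⊆ vanishing (weights a b) q ↔ p ∣ q) := by
    intro q e hq
    rw [hP]
    exact vanishing_subset_iff hp hq hirr
  have hfin : ∀ {q : Cox}, q ≠ 0 → FiniteMultiplicity p q := fun hq =>
    FiniteMultiplicity.of_prime_left hirr.prime hq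
  set A := (localRing (weights a b) (P.1 : Set (Variety (weights a b)))
    P.1.isIrreducible').toSubring
  set π : CoxField := algebraMap Cox CoxField (p * D) / algebraMap Cox CoxField N
  have hmem : ∀ {F G : Cox} {d : ℤ × ℤ}, IsWeightedHomogeneous (weights a b) F d →
      IsWeightedHomogeneous (weights a b) G d → ¬ p ∣ G →
      algebraMap Cox CoxField F / algebraMap Cox CoxField G ∈ A := fun hF hG h =>
    div_mem_localRing P.1.isIrreducible' hF hG (mt (hdvd hG).mp h)
  have hπ0 : π ≠ 0 := div_ne_zero (algebraMap_ne_zero (mul_ne_zero hirr.ne_zero (ne0 hpD)))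
    (algebraMap_ne_zero (ne0 hpN))
  have hp0 := algebraMap_ne_zero hirr.ne_zero
  have hN0 := algebraMap_ne_zero (ne0 hpN)
  have hD0 := algebraMap_ne_zero (ne0 hpD)
  -- the decomposition of a fraction as a power of `π` times a unit
  have hdec : ∀ {F G : Cox} {f : ℤ × ℤ}, IsWeightedHomogeneous (weights a b) F f →
      IsWeightedHomogeneous (weights a b) G f → F ≠ 0 → G ≠ 0 →
      ∃ u : CoxField, u ≠ 0 ∧ u ∈ A ∧ u⁻¹ ∈ A ∧
        algebraMap Cox CoxField F / algebraMap Cox CoxField G =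
          π ^ ((multiplicity p F : ℤ) - multiplicity p G) * u := by
    intro F G f hF hG hF0 hG0
    obtain ⟨F', hF', hpF'⟩ := (hfin hF0).exists_eq_pow_mul_and_not_dvd
    obtain ⟨G', hG', hpG'⟩ := (hfin hG0).exists_eq_pow_mul_and_not_dvd
    set s := multiplicity p F
    set t := multiplicity p G
    obtain ⟨f₁, hf₁⟩ := isWeightedHomogeneous_of_dvd hF hF0 (Dvd.intro_left _ hF'.symm)
    obtain ⟨g₁, hg₁⟩ := isWeightedHomogeneous_of_dvd hG hG0 (Dvd.intro_left _ hG'.symm)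
    have e₁ : s • d + f₁ = f := IsWeightedHomogeneous.inj_right hF0
      (by rw [hF']; exact (hp.pow s).mul hf₁) hF
    have e₂ : t • d + g₁ = f := IsWeightedHomogeneous.inj_right hG0
      (by rw [hG']; exact (hp.pow t).mul hg₁) hG
    have hnum : ¬ p ∣ F' * (N ^ s * D ^ t) := by
      intro h
      rcases hirr.prime.dvd_or_dvd h with h | h
      · exact hpF' h
      rcases hirr.prime.dvd_or_dvd h with h | h
      · exact hpN (hirr.prime.dvd_of_dvd_pow h)
      · exact hpD (hirr.prime.dvd_of_dvd_pow h)
    have hden : ¬ p ∣ G' * (N ^ t * D ^ s) := by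
      intro h
      rcases hirr.prime.dvd_or_dvd h with h | h
      · exact hpG' h
      rcases hirr.prime.dvd_or_dvd h with h | h
      · exact hpN (hirr.prime.dvd_of_dvd_pow h)
      · exact hpD (hirr.prime.dvd_of_dvd_pow h)
    have hnum' : IsWeightedHomogeneous (weights a b) (F' * (N ^ s * D ^ t))
        (f + (s • e + t • e)) := by
      convert hf₁.mul ((hN.pow s).mul (hD.pow t)) using 1
      rw [← e₁, smul_add]
      abel
    have hden' : IsWeightedHomogeneous (weights a b) (G' * (N ^ t * D ^ s))
        (f + (s • e + t • e)) := by
      convert hg₁.mul ((hN.pow t).mul (hD.pow s)) using 1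
      rw [← e₂, smul_add]
      abel
    refine ⟨_, div_ne_zero (algebraMap_ne_zero (ne0 hnum)) (algebraMap_ne_zero (ne0 hden)),
      hmem hnum' hden' hden, ?_, ?_⟩
    · rw [inv_div]
      exact hmem hden' hnum' hnum
    · have hF'0 := algebraMap_ne_zero (ne0 hpF')
      have hG'0 := algebraMap_ne_zero (ne0 hpG')
      rw [zpow_sub₀ hπ0, zpow_natCast, zpow_natCast]
      rw [show algebraMap Cox CoxField F = algebraMap Cox CoxField (p ^ s * F') by rw [← hF'],
        show algebraMap Cox CoxField G = algebraMap Cox CoxField (p ^ t * G') by rw [← hG']]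
      simp only [π, map_mul, map_pow, div_pow, mul_pow]
      field_simp
  obtain ⟨u, hu0, hu, hu', hFG⟩ := hdec hF hG hF0 hG0
  rw [hFG]
  have hπA : π ∈ A := hmem (by
    convert hp.mul hD using 1) hN hpN
  refine orderAlong_zpow_mul hπA hπ0 ?_ ?_ hu0 hu hu' _
  · intro h
    obtain ⟨f', F', G', hF', hG', hpG', h'⟩ := exists_eq_div_of_mem_localRing P.1.isIrreducible' h
    replace hpG' : ¬ p ∣ G' := mt (hdvd hG').mpr hpG'
    rw [inv_div, div_eq_div_iff (algebraMap_ne_zero (mul_ne_zero hirr.ne_zero (ne0 hpD)))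
      (algebraMap_ne_zero (ne0 hpG')), ← map_mul, ← map_mul] at h'
    have h'' := IsFractionRing.injective Cox CoxField h'
    have : p ∣ N * G' := by
      rw [h'']
      exact ((dvd_mul_right p D).mul_left F')
    exact (hirr.prime.dvd_or_dvd this).elim hpN hpG'
  · intro x hx hx'
    obtain ⟨f', F', G', hF', hG', hpG', rfl⟩ := exists_eq_div_of_mem_localRing P.1.isIrreducible' hx
    replace hpG' : ¬ p ∣ G' := mt (hdvd hG').mpr hpG'
    by_cases hF'0 : F' = 0
    · rw [hF'0, map_zero, zero_div, zero_div]
      exact zero_mem _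
    obtain ⟨v, hv0, hv, hv', h⟩ := hdec hF' hG' hF'0 (ne0 hpG')
    rw [multiplicity_eq_zero.mpr hpG', Nat.cast_zero, sub_zero, zpow_natCast] at h
    have hF'1 : multiplicity p F' ≠ 0 := by
      intro h0
      rw [h0, pow_zero, one_mul] at h
      exact hx' (h ▸ hv')
    obtain ⟨k, hk⟩ := Nat.exists_eq_succ_of_ne_zero hF'1
    rw [h, hk, show π ^ (k + 1) * v / π = π ^ k * v by rw [pow_succ]; field_simp]
    exact mul_mem (pow_mem hπA k) hv

/-- The toric variety is normal: a rational function with trivial order along all prime divisors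
containing `Z` is regular at the generic point of `Z`. -/
theorem mem_localRing_of_forall_ord_eq_zero {a b : Fin 4 → ℕ} {j₁ j₂ : Fin 4} (hj : j₁ ≠ j₂)
    (h₁ : b j₁ = 1) (h₂ : b j₂ = 1) {Z : Set (Variety (weights a b))} (hZ : IsIrreducible Z)
    {φ : CoxField} (hφ : φ ∈ functionField (weights a b)) (hφ0 : φ ≠ 0)
    (h : ∀ P : PrimeDivisor (weights a b), Z ⊆ (P.1 : Set (Variety (weights a b))) →
      P.ord φ = 0) : φ ∈ localRing (weights a b) Z hZ := by
  obtain ⟨d, F, G, hF, hG, hG0, rfl⟩ := hφ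
  have hF0 : F ≠ 0 := by
    rintro rfl
    simp at hφ0
  obtain ⟨F', G', c, hrel, rfl, rfl⟩ := UniqueFactorizationMonoid.exists_reduced_factors F hF0 G
  have hc0 : c ≠ 0 := left_ne_zero_of_mul hG0
  have hF'0 : F' ≠ 0 := right_ne_zero_of_mul hF0
  have hG'0 : G' ≠ 0 := right_ne_zero_of_mul hG0
  obtain ⟨e, he⟩ := isWeightedHomogeneous_of_dvd hF hF0 (dvd_mul_right c F')
  obtain ⟨f, hf⟩ := isWeightedHomogeneous_of_dvd hF hF0 (dvd_mul_left F' c)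
  obtain ⟨g, hg⟩ := isWeightedHomogeneous_of_dvd hG hG0 (dvd_mul_left G' c)
  have hfg : g = f := add_left_cancel
    ((IsWeightedHomogeneous.inj_right hG0 (he.mul hg) hG).trans
      (IsWeightedHomogeneous.inj_right hF0 (he.mul hf) hF).symm)
  subst hfg
  have heq : algebraMap Cox CoxField (c * F') / algebraMap Cox CoxField (c * G') =
      algebraMap Cox CoxField F' / algebraMap Cox CoxField G' := by
    rw [map_mul, map_mul, mul_div_mul_left _ _ (algebraMap_ne_zero hc0)]
  rw [heq] at h ⊢
  refine div_mem_localRing hZ hf hg fun hZG => ?_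
  obtain ⟨e', p, hp, hirr, hpG, hZp⟩ := exists_irreducible_factor hZ hg hG'0 hZG
  have := h (vanishingDivisor hp hirr) hZp
  rw [PrimeDivisor.ord_div hj h₁ h₂ _ hp hirr rfl hf hg hF'0 hG'0] at this
  have hpF : ¬ p ∣ F' := fun hpF => hirr.not_isUnit (hrel hpF hpG)
  rw [multiplicity_eq_zero.mpr hpF] at this
  have hpG' : multiplicity p G' ≠ 0 := fun h0 => multiplicity_eq_zero.mp h0 hpG
  omega

lemma PrimeDivisor.ord_mul {a b : Fin 4 → ℕ} {j₁ j₂ : Fin 4} (hj : j₁ ≠ j₂) (h₁ : b j₁ = 1)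
    (h₂ : b j₂ = 1) (P : PrimeDivisor (weights a b)) {f g : CoxField}
    (hf : f ∈ functionField (weights a b)) (hg : g ∈ functionField (weights a b)) (hf0 : f ≠ 0)
    (hg0 : g ≠ 0) : P.ord (f * g) = P.ord f + P.ord g := by
  obtain ⟨d, F, G, hF, hG, hG0, rfl⟩ := hf
  obtain ⟨d', F', G', hF', hG', hG0', rfl⟩ := hg
  have hF0 : F ≠ 0 := by
    rintro rfl
    simp at hf0
  have hF0' : F' ≠ 0 := by
    rintro rfl
    simp at hg0
  obtain ⟨p, e, hp, hirr, hP⟩ := PrimeDivisor.exists_eq_vanishing P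
  have hfin : ∀ {q : Cox}, q ≠ 0 → FiniteMultiplicity p q := fun hq =>
    FiniteMultiplicity.of_prime_left hirr.prime hq
  rw [div_mul_div_comm, ← map_mul, ← map_mul,
    PrimeDivisor.ord_div hj h₁ h₂ P hp hirr hP (hF.mul hF') (hG.mul hG') (mul_ne_zero hF0 hF0')
      (mul_ne_zero hG0 hG0'),
    PrimeDivisor.ord_div hj h₁ h₂ P hp hirr hP hF hG hF0 hG0,
    PrimeDivisor.ord_div hj h₁ h₂ P hp hirr hP hF' hG' hF0' hG0',
    multiplicity_mul hirr.prime (hfin (mul_ne_zero hF0 hF0')),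
    multiplicity_mul hirr.prime (hfin (mul_ne_zero hG0 hG0'))]
  push_cast
  ring

lemma PrimeDivisor.ord_one {w : Var → ℤ × ℤ} (P : PrimeDivisor w) : P.ord 1 = 0 :=
  orderAlong_unit one_ne_zero (one_mem _) (by rw [inv_one]; exact one_mem _)

lemma PrimeDivisor.ord_inv {a b : Fin 4 → ℕ} {j₁ j₂ : Fin 4} (hj : j₁ ≠ j₂) (h₁ : b j₁ = 1)
    (h₂ : b j₂ = 1) (P : PrimeDivisor (weights a b)) {f : CoxField}
    (hf : f ∈ functionField (weights a b)) (hf0 : f ≠ 0) : P.ord f⁻¹ = -P.ord f := by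
  have := PrimeDivisor.ord_mul hj h₁ h₂ P hf (inv_mem hf) hf0 (inv_ne_zero hf0)
  rw [mul_inv_cancel₀ hf0, PrimeDivisor.ord_one P] at this
  omega

lemma PrimeDivisor.ord_pow {a b : Fin 4 → ℕ} {j₁ j₂ : Fin 4} (hj : j₁ ≠ j₂) (h₁ : b j₁ = 1)
    (h₂ : b j₂ = 1) (P : PrimeDivisor (weights a b)) {f : CoxField}
    (hf : f ∈ functionField (weights a b)) (hf0 : f ≠ 0) (m : ℕ) :
    P.ord (f ^ m) = m * P.ord f := by
  induction m with
  | zero => simp [PrimeDivisor.ord_one P]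
  | succ m ih =>
    rw [pow_succ, PrimeDivisor.ord_mul hj h₁ h₂ P (pow_mem hf m) hf (pow_ne_zero m hf0) hf0, ih]
    push_cast
    ring

/-! ### The degree of a principal divisor on a curve -/

section ProductFormula

open IsDedekindDomain WithZero Polynomial

/-- On the valuation ring of a maximal ideal of a Dedekind domain, `orderAlong` is the additive
valuation. -/
lemma orderAlong_valuationSubring {B K : Type*} [CommRing B] [IsDedekindDomain B] [Field K]
    [Algebra B K] [IsFractionRing B K] (v : HeightOneSpectrum B) {x : K} {n : ℤ}
    (hx : v.valuation K x = exp (-n)) :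
    orderAlong (v.valuation K).valuationSubring.toSubring x = n := by
  obtain ⟨π, hπ⟩ := v.valuation_exists_uniformizer K
  have hmem : ∀ y : K, y ∈ (v.valuation K).valuationSubring.toSubring ↔ v.valuation K y ≤ 1 :=
    fun y => Iff.rfl
  have hlt : (exp (-1 : ℤ) : ℤᵐ⁰) < 1 := by
    rw [← exp_zero, exp_lt_exp]
    norm_num
  have hπ0 : π ≠ 0 := by
    rintro rfl
    rw [map_zero] at hπ
    exact exp_ne_zero hπ.symm
  have hu : v.valuation K (π ^ (-n) * x) = 1 := by
    rw [map_mul, map_zpow₀, hπ, hx, ← exp_zsmul, ← exp_add, ← exp_zero]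
    congr 1
    simp
  have hu0 : π ^ (-n) * x ≠ 0 := by
    intro h
    rw [h, map_zero] at hu
    exact zero_ne_one hu
  have hxe : x = π ^ n * (π ^ (-n) * x) := by
    rw [← mul_assoc, ← zpow_add₀ hπ0]
    simp
  rw [hxe]
  refine orderAlong_zpow_mul ((hmem _).mpr (hπ ▸ hlt.le)) hπ0 ?_ ?_ hu0 ((hmem _).mpr hu.le)
    ((hmem _).mpr (by rw [map_inv₀, hu, inv_one])) n
  · rw [hmem, map_inv₀, hπ, not_le]
    rw [← exp_neg, ← exp_zero, exp_lt_exp]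
    norm_num
  · intro f _ hf'
    rw [hmem] at hf' ⊢
    by_cases hf0 : f = 0
    · simp [hf0]
    have hvf : v.valuation K f ≠ 0 := (Valuation.ne_zero_iff _).mpr hf0
    rw [map_inv₀, not_le] at hf'
    have hf1 : v.valuation K f < 1 := (one_lt_inv₀ (zero_lt_iff.mpr hvf)).mp hf'
    rw [map_div₀, hπ]
    obtain ⟨m, hm⟩ : ∃ m : ℤ, v.valuation K f = exp m := ⟨_, (exp_log hvf).symm⟩
    rw [hm, ← exp_zero, exp_lt_exp] at hf1
    rw [hm, ← exp_sub, ← exp_zero, exp_le_exp]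
    omega

/-- The places of the function field `K` over `k`: its nontrivial valuation rings containing `k`. -/
abbrev Place (k K : Type*) [Field k] [Field K] [Algebra k K] : Type _ :=
  {v : ValuationSubring K // (∀ c : k, algebraMap k K c ∈ v) ∧ v ≠ ⊤}

variable {k K : Type*} [Field k] [Field K] [Algebra k K]

/-- The order of the zero of `t` at a place, and `0` at the places where `t` has no zero. -/
noncomputable def zeroOrder (t : K) (v : Place k K) : ℤ :=
  open Classical in if t⁻¹ ∈ v.1 then 0 else orderAlong v.1.toSubring t

lemma orderAlong_eq_zeroOrder_sub {t : K} (ht : t ≠ 0) (v : Place k K) :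
    orderAlong v.1.toSubring t = zeroOrder t v - zeroOrder t⁻¹ v := by
  unfold zeroOrder
  rw [inv_inv]
  by_cases h1 : t ∈ v.1 <;> by_cases h2 : t⁻¹ ∈ v.1
  · rw [if_pos h1, if_pos h2, sub_zero]
    exact orderAlong_unit ht h1 h2
  · rw [if_pos h1, if_neg h2, sub_zero]
  · rw [if_neg h1, if_pos h2, zero_sub]
    have h1' : t ∉ v.1.toSubring := h1
    have h2' : t⁻¹ ∈ v.1.toSubring := h2
    rw [orderAlong, dif_neg h1', dif_pos h2', orderAlong, dif_pos h2']
  · exact absurd (v.1.mem_or_inv_mem t) (by tauto)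

section
variable {t : K}

lemma exists_eq_add_mul_of_mem_adjoin {x : K} (hx : x ∈ Algebra.adjoin k {t}) :
    ∃ (c : k), ∃ y ∈ Algebra.adjoin k {t}, x = algebraMap k K c + t * y := by
  rw [Algebra.adjoin_singleton_eq_range_aeval] at hx ⊢
  obtain ⟨f, rfl⟩ := hx
  refine ⟨f.coeff 0, _, ⟨f.divX, rfl⟩, ?_⟩
  conv_lhs => rw [← f.X_mul_divX_add]
  simp only [AlgHom.toRingHom_eq_coe, RingHom.coe_coe, map_add, map_mul, Polynomial.aeval_X,
    Polynomial.aeval_C]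
  exact add_comm _ _

instance : IsPrincipalIdealRing (Algebra.adjoin k {t}) :=
  IsPrincipalIdealRing.of_surjective
    ((Subalgebra.equivOfEq _ _ (Algebra.adjoin_singleton_eq_range_aeval k t).symm).toAlgHom.comp
      (Polynomial.aeval t : k[X] →ₐ[k] K).rangeRestrict).toRingHom
    ((Subalgebra.equivOfEq _ _ (Algebra.adjoin_singleton_eq_range_aeval k t).symm).surjective.comp
      (AlgHom.rangeRestrict_surjective _))

/-- `t` as an element of `k[t]`. -/
def adjoinGen (k : Type*) {K : Type*} [Field k] [Field K] [Algebra k K] (t : K) :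
    Algebra.adjoin k {t} := ⟨t, Algebra.self_mem_adjoin_singleton k t⟩

lemma isMaximal_span_adjoinGen (ht : Transcendental k t) :
    (Ideal.span {adjoinGen k t}).IsMaximal := by
  refine Ideal.isMaximal_iff.mpr ⟨fun h => ?_, fun J x hJ hx hxJ => ?_⟩
  · obtain ⟨⟨y, hy⟩, hxy⟩ := Ideal.mem_span_singleton.mp h
    rw [Algebra.adjoin_singleton_eq_range_aeval] at hy
    obtain ⟨f, rfl⟩ := hy
    have h1 : (1 : K) = t * Polynomial.aeval t f := congrArg Subtype.val hxy
    have h2 : Polynomial.aeval t (Polynomial.X * f - 1) = 0 := by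
      rw [map_sub, map_mul, Polynomial.aeval_X, map_one, ← h1, sub_self]
    have h3 := (transcendental_iff.mp ht) _ h2
    have := congrArg (Polynomial.eval 0) h3
    simp at this
  · obtain ⟨c, y, hy, hxy⟩ := exists_eq_add_mul_of_mem_adjoin x.2
    have hx' : x = algebraMap k _ c + adjoinGen k t * ⟨y, hy⟩ := Subtype.ext hxy
    have hc : c ≠ 0 := by
      rintro rfl
      apply hx
      rw [hx', map_zero, zero_add]
      exact Ideal.mul_mem_right _ _ (Ideal.mem_span_singleton_self _)
    have hcJ : algebraMap k _ c ∈ J := by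
      have := J.sub_mem hxJ (J.mul_mem_right ⟨y, hy⟩ (hJ (Ideal.mem_span_singleton_self _)))
      rwa [hx', add_sub_cancel_right] at this
    have := J.mul_mem_left (algebraMap k _ c⁻¹) hcJ
    rwa [← map_mul, inv_mul_cancel₀ hc, map_one] at this

lemma inertiaDeg_eq_one_of_isAlgClosed [IsAlgClosed k] {A B : Type*} [CommRing A] [CommRing B]
    [Algebra A B] [Algebra k A] [Algebra k B] [IsScalarTower k A B] [Module.Finite A B]
    {p : Ideal A} [p.IsMaximal] (hp : Function.Surjective (algebraMap k (A ⧸ p))) (Q : Ideal B)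
    [Q.IsPrime] [Q.LiesOver p] : Q.inertiaDeg A = 1 := by
  have hQmax : Q.IsMaximal := Ideal.IsMaximal.of_liesOver_isMaximal Q p
  rw [Ideal.inertiaDeg_eq_of_isMaximal p Q]
  let _ : Field (A ⧸ p) := Ideal.Quotient.field p
  let _ : Field (B ⧸ Q) := Ideal.Quotient.field Q
  have : Algebra.IsIntegral k (A ⧸ p) := Algebra.isIntegral_of_surjective hp
  have htower : ∀ c : k,
      algebraMap k (B ⧸ Q) c = algebraMap (A ⧸ p) (B ⧸ Q) (algebraMap k _ c) := by
    intro c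
    change Ideal.Quotient.mk Q (algebraMap k B c) =
      Ideal.Quotient.mk Q (algebraMap A B (algebraMap k A c))
    rw [← IsScalarTower.algebraMap_apply k A B]
  have : IsScalarTower k (A ⧸ p) (B ⧸ Q) := IsScalarTower.of_algebraMap_eq htower
  have : Algebra.IsIntegral k (B ⧸ Q) := Algebra.IsIntegral.trans (A ⧸ p)
  refine (finrank_eq_one_iff_of_nonzero' (1 : B ⧸ Q) one_ne_zero).mpr fun x => ?_
  obtain ⟨c, rfl⟩ := (IsAlgClosed.algebraMap_bijective_of_isIntegral (k := k)).2 x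
  exact ⟨algebraMap k (A ⧸ p) c, by rw [← Algebra.algebraMap_eq_smul_one, htower]⟩

lemma finiteDimensional_adjoin_of_transcendental [Algebra.EssFiniteType k K]
    (hK : Algebra.trdeg k K = 1) (ht : Transcendental k t) :
    FiniteDimensional (IntermediateField.adjoin k {t}) K := by
  have hindep : AlgebraicIndependent k (fun _ : Unit => t) :=
    algebraicIndependent_unique_type_iff.mpr ht
  have hbasis := hindep.isTranscendenceBasis_of_lift_trdeg_le_of_finite (by simp [hK])
  have hrange : Set.range (fun _ : Unit => t) = {t} := Set.range_const
  have : Algebra.IsAlgebraic (IntermediateField.adjoin k {t}) K := by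
    have := hbasis.isAlgebraic_field
    rwa [hrange] at this
  have : Algebra.EssFiniteType (IntermediateField.adjoin k {t}) K :=
    Algebra.EssFiniteType.of_comp k _ K
  exact Algebra.finite_of_essFiniteType_of_isAlgebraic

variable [IsAlgClosed k] [CharZero k]

set_option maxHeartbeats 1000000 in
open IntermediateField.algebraAdjoinAdjoin in
/-- A nonconstant function `t` has `[K : k(t)]` zeros, counted with multiplicity. The zeros are
the maximal ideals over `(t)` of the integral closure of `k[t]` in `K`, their multiplicities are
the ramification indices, and the residue degrees are `1`. -/
theorem finsum_zeroOrder (ht : Transcendental k t)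
    [FiniteDimensional (IntermediateField.adjoin k {t}) K] :
    (Function.support (zeroOrder (k := k) t)).Finite ∧
      ∑ᶠ v : Place k K, zeroOrder t v = Module.finrank (IntermediateField.adjoin k {t}) K := by
  classical
  set A := Algebra.adjoin k {t}
  set F := IntermediateField.adjoin k {t}
  set B := integralClosure A K
  have : CharZero F := charZero_of_injective_algebraMap (algebraMap k F).injective
  have : IsFractionRing B K := integralClosure.isFractionRing_of_finite_extension F K
  have : IsDedekindDomain B := integralClosure.isDedekindDomain A F K
  have : Module.Finite A B := IsIntegralClosure.finite A F K B
  set p : Ideal A := Ideal.span {adjoinGen k t}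
  have hp : p.IsMaximal := isMaximal_span_adjoinGen ht
  have ht0 : t ≠ 0 := by
    rintro rfl
    exact ht isAlgebraic_zero
  have hfin : Finite (p.primesOver B) := Algebra.QuasiFinite.finite_primesOver p
  have : Fintype (p.primesOver B) := Fintype.ofFinite _
  let tB : B := algebraMap A B (adjoinGen k t)
  have htB : algebraMap B K tB = t := rfl
  have htB0 : tB ≠ 0 := by
    intro h
    rw [h, map_zero] at htB
    exact ht0 htB.symm
  have hmap : p.map (algebraMap A B) = Ideal.span {tB} := by
    rw [Ideal.map_span, Set.image_singleton]
  have hmap0 : p.map (algebraMap A B) ≠ ⊥ := by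
    rw [hmap, Ne, Ideal.span_singleton_eq_bot]
    exact htB0
  have hmemq : ∀ q : p.primesOver B, tB ∈ q.1 := by
    intro q
    have := q.2.2
    exact (Ideal.map_le_of_le_comap (q.1.over_def p).le)
      (hmap ▸ Ideal.mem_span_singleton_self tB : tB ∈ p.map (algebraMap A B))
  let ht1 : p.primesOver B → HeightOneSpectrum B := fun q =>
    ⟨q.1, q.2.1, fun h => htB0 (by simpa [h] using hmemq q)⟩
  have hvt : ∀ q, (ht1 q).valuation K t < 1 := fun q => by
    exact ((ht1 q).valuation_lt_one_iff_mem tB).mpr (hmemq q)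
  have htinv : ∀ q, t⁻¹ ∉ ((ht1 q).valuation K).valuationSubring := fun q => by
    rw [Valuation.mem_valuationSubring_iff, map_inv₀, not_le]
    exact (one_lt_inv₀ (zero_lt_iff.mpr ((Valuation.ne_zero_iff _).mpr ht0))).mpr (hvt q)
  let Φ : p.primesOver B → Place k K := fun q =>
    ⟨((ht1 q).valuation K).valuationSubring, fun c => by
      rw [Valuation.mem_valuationSubring_iff]
      exact (ht1 q).valuation_le_one (algebraMap k B c), fun h => htinv q (h ▸ trivial)⟩
  have hΦ : Function.Injective Φ := by
    intro q q' h
    have h' : ((ht1 q).valuation K).valuationSubring = ((ht1 q').valuation K).valuationSubring :=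
      congrArg Subtype.val h
    have := HeightOneSpectrum.eq_of_valuation_isEquiv_valuation
      ((Valuation.isEquiv_iff_valuationSubring _ _).mpr h')
    exact Subtype.ext (congrArg HeightOneSpectrum.asIdeal this)
  -- every zero of `t` comes from a maximal ideal of `B`
  have hrange : ∀ v : Place k K, t⁻¹ ∉ v.1 → v ∈ Set.range Φ := by
    intro v hv
    have htv : t ∈ v.1 := (v.1.mem_or_inv_mem t).resolve_right hv
    have hA : A.toSubring ≤ v.1.toSubring := by
      let S : Subalgebra k K := { v.1.toSubring with algebraMap_mem' := v.2.1 }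
      exact fun x hx => (Algebra.adjoin_le (S := S) (Set.singleton_subset_iff.mpr htv)) hx
    have hB : ∀ x : B, (x : K) ∈ v.1 := by
      intro x
      let _ : Algebra A v.1 := (Subring.inclusion hA).toAlgebra
      have : IsScalarTower A v.1 K := IsScalarTower.of_algebraMap_eq fun _ => rfl
      obtain ⟨y, hy⟩ := IsIntegrallyClosed.isIntegral_iff.mp (x.2.tower_top (A := v.1))
      rw [← hy]
      exact y.2
    let i : B →+* v.1 := (algebraMap B K).codRestrict v.1.toSubring hB
    set Q : Ideal B := (IsLocalRing.maximalIdeal v.1).comap i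
    have hQmem : ∀ x : B, x ∈ Q ↔ (x : K) ∈ v.1.nonunits := fun x => by
      rw [ValuationSubring.mem_nonunits_iff_exists_mem_maximalIdeal]
      exact ⟨fun h => ⟨hB x, h⟩, fun ⟨_, h⟩ => h⟩
    have hQt : tB ∈ Q := by
      rw [hQmem]
      exact (ValuationSubring.mem_nonunits_iff_or _).mpr (Or.inr hv)
    have hQover : Q.LiesOver p := by
      refine ⟨hp.eq_of_le (Ideal.IsPrime.ne_top inferInstance) ?_⟩
      rw [Ideal.span_singleton_le_iff_mem]
      exact hQt
    let q : p.primesOver B := ⟨Q, inferInstance, hQover⟩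
    refine ⟨q, Subtype.ext (ValuationSubring.eq_of_le_of_ne_top _ ?_ v.2.2)⟩
    intro x hx
    obtain ⟨n, d, hnd⟩ := (ht1 q).exists_primeCompl_mul_eq_of_integer x hx
    have hd : (d.1 : K) ∉ v.1.nonunits := fun h => d.2 ((hQmem d.1).mpr h)
    rw [ValuationSubring.mem_nonunits_iff_or, not_or, not_not] at hd
    rw [show x = n * (d.1 : K)⁻¹ from (eq_mul_inv_iff_mul_eq₀ hd.1).mpr hnd]
    exact mul_mem (hB n) hd.2
  have hord : ∀ q, zeroOrder t (Φ q) = (q.1.ramificationIdx A : ℤ) := by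
    intro q
    have := q.2.1
    have := q.2.2
    rw [zeroOrder, if_neg (show t⁻¹ ∉ (Φ q).1 from htinv q),
      Ideal.IsDedekindDomain.ramificationIdx_eq_multiplicity p q.1 hmap0]
    apply orderAlong_valuationSubring
    rw [hmap]
    exact ((ht1 q).valuation_of_algebraMap tB).trans
      ((ht1 q).intValuation_eq_exp_neg_multiplicity htB0)
  have hinertia : ∀ q : p.primesOver B, q.1.inertiaDeg A = 1 := by
    rintro ⟨Q, hQ, hQp⟩
    refine inertiaDeg_eq_one_of_isAlgClosed (k := k) (p := p) (fun x => ?_) Q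
    obtain ⟨x, rfl⟩ := Ideal.Quotient.mk_surjective x
    obtain ⟨c, y, hy, hxy⟩ := exists_eq_add_mul_of_mem_adjoin x.2
    refine ⟨c, ?_⟩
    have hx : x = algebraMap k A c + adjoinGen k t * ⟨y, hy⟩ := Subtype.ext hxy
    rw [hx, map_add, Ideal.Quotient.eq_zero_iff_mem.mpr
      (Ideal.mul_mem_right _ _ (Ideal.mem_span_singleton_self _)), add_zero]
    rfl
  have hsupp : Function.support (zeroOrder (k := k) t) ⊆ Set.range Φ := by
    intro v hv
    apply hrange v
    intro h
    exact hv (by rw [zeroOrder, if_pos h])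
  refine ⟨(Set.finite_range Φ).subset hsupp, ?_⟩
  rw [← finsum_mem_univ, ← finsum_mem_inter_support, Set.univ_inter,
    ← Set.inter_eq_right.mpr hsupp, finsum_mem_inter_support, finsum_mem_range hΦ,
    finsum_eq_sum_of_fintype, IsFractionRing.finrank_eq A F B K,
    ← Ideal.sum_ramification_inertia_eq_finrank p B]
  push_cast
  exact Finset.sum_congr rfl fun q _ => by rw [hord, hinertia, Nat.cast_one, mul_one]

/-- A nonzero rational function on a complete curve has as many zeros as poles. -/
theorem finsum_orderAlong_eq_zero [Algebra.EssFiniteType k K] (hK : Algebra.trdeg k K = 1)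
    (ht : t ≠ 0) : ∑ᶠ v : Place k K, orderAlong v.1.toSubring t = 0 := by
  by_cases htr : Transcendental k t
  -- zeros and poles of `t` both number `[K : k(t)]`
  · have htr' : Transcendental k t⁻¹ := fun h => htr (by simpa using h.inv)
    have := finiteDimensional_adjoin_of_transcendental hK htr
    have := finiteDimensional_adjoin_of_transcendental hK htr'
    obtain ⟨hfin, hsum⟩ := finsum_zeroOrder htr
    obtain ⟨hfin', hsum'⟩ := finsum_zeroOrder htr'
    have hadj : IntermediateField.adjoin k {t⁻¹} = IntermediateField.adjoin k {t} := by
      refine le_antisymm ?_ ?_ <;> rw [IntermediateField.adjoin_simple_le_iff]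
      · exact inv_mem (IntermediateField.mem_adjoin_simple_self k t)
      · simpa using inv_mem (IntermediateField.mem_adjoin_simple_self k t⁻¹)
    simp_rw [orderAlong_eq_zeroOrder_sub ht]
    rw [finsum_sub_distrib hfin hfin', hsum, hsum', hadj, sub_self]
  · have halg : IsAlgebraic k t := not_not.mp htr
    obtain ⟨c, rfl⟩ : ∃ c, algebraMap k K c = t := by
      have hint := halg.isIntegral
      have hdeg := IsAlgClosed.degree_eq_one_of_irreducible k (minpoly.irreducible hint)
      exact minpoly.mem_range_of_degree_eq_one k t hdeg
    rw [← finsum_zero (α := Place k K)]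
    refine finsum_congr fun v => orderAlong_unit ht (v.2.1 c) ?_
    rw [← map_inv₀]
    exact v.2.1 c⁻¹

end
end ProductFormula

/-! ### Function fields of subvarieties are finitely generated -/

/-- The monomial with exponents `e` divided by the Laurent monomial of the same weight. -/
noncomputable def degreeZeroMonomial (a b : Fin 4 → ℕ) (i : Fin 2) (j : Fin 4)
    (e : Var →₀ ℕ) : CoxField :=
  algebraMap Cox CoxField (monomial e 1) / laurent a b i j (Finsupp.weight (weights a b) e)

lemma eval_ne_zero_of_mem_closure {i : Fin 2} {j : Fin 4} {z : Var → ℂ} (hi : z (Sum.inl i) ≠ 0)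
    (hj : z (Sum.inr j) ≠ 0) {N : Cox}
    (hN : N ∈ Submonoid.closure {(X (Sum.inl i) : Cox), X (Sum.inr j)}) : eval z N ≠ 0 := by
  induction hN using Submonoid.closure_induction with
  | mem x hx =>
    rcases hx with rfl | rfl
    · rwa [eval_X]
    · rwa [eval_X]
  | one => simp
  | mul x y _ _ hx hy =>
    rw [map_mul]
    exact mul_ne_zero hx hy

section

variable {a b : Fin 4 → ℕ} {i : Fin 2} {j : Fin 4} {Z : Set (Variety (weights a b))} {z : CoxOpen}

lemma div_laurent_mem_localRing (hZ : IsIrreducible Z) (hz : quot _ z ∈ Z)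
    (hi : z.1 (Sum.inl i) ≠ 0) (hj : z.1 (Sum.inr j) ≠ 0) (hbj : b j ≠ 0) {p : Cox} {d : ℤ × ℤ}
    (hp : IsWeightedHomogeneous (weights a b) p d) (hd : (b j : ℤ) ∣ d.2) :
    algebraMap Cox CoxField p / laurent a b i j d ∈ localRing (weights a b) Z hZ := by
  obtain ⟨N, hN, D, hD, e, hNe, hDe, h⟩ := exists_laurent_eq_div (a := a) i hbj hd
  have hN' : ¬ Z ⊆ vanishing (weights a b) N := fun h' =>
    eval_ne_zero_of_mem_closure hi hj hN ((quot_mem_vanishing hNe z).mp (h' hz))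
  rw [h, div_div_eq_mul_div, ← map_mul]
  exact div_mem_localRing hZ (hp.mul hDe) hNe hN'

lemma laurent_div_mem_localRing (hZ : IsIrreducible Z) (hz : quot _ z ∈ Z)
    (hi : z.1 (Sum.inl i) ≠ 0) (hj : z.1 (Sum.inr j) ≠ 0) (hbj : b j ≠ 0) {q : Cox} {d : ℤ × ℤ}
    (hq : IsWeightedHomogeneous (weights a b) q d)
    (hqZ : (Z ∩ nonvanishing (weights a b) q).Nonempty) (hd : (b j : ℤ) ∣ d.2) :
    laurent a b i j d / algebraMap Cox CoxField q ∈ localRing (weights a b) Z hZ := by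
  obtain ⟨N, hN, D, hD, e, hNe, hDe, h⟩ := exists_laurent_eq_div (a := a) i hbj hd
  rw [h, div_div, ← map_mul]
  refine ⟨d + e, N, D * q, hNe, by rw [add_comm]; exact hDe.mul hq, ?_, rfl⟩
  exact nonvanishing_mul hZ hDe hq ⟨_, hz, z, rfl, eval_ne_zero_of_mem_closure hi hj hD⟩ hqZ

/-- A subalgebra containing the degree zero monomials with small exponents contains all quotients
of homogeneous polynomials of even weight by Laurent monomials, as squares can be split off. -/
lemma div_laurent_mem_of_forall_le (hb : ∀ j, b j ∣ 2) (W : Subalgebra ℂ CoxField)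
    (hW : ∀ e : Var →₀ ℕ, (∀ l, e l ≤ 2) → 2 ∣ (Finsupp.weight (weights a b) e).2 →
      degreeZeroMonomial a b i j e ∈ W) {p : Cox} {d : ℤ × ℤ}
    (hp : IsWeightedHomogeneous (weights a b) p d) (hd : 2 ∣ d.2) :
    algebraMap Cox CoxField p / laurent a b i j d ∈ W := by
  have hbj : (b j : ℤ) ∣ 2 := by exact_mod_cast hb j
  have hmon : ∀ (n : ℕ) (e : Var →₀ ℕ), e.degree = n →
      2 ∣ (Finsupp.weight (weights a b) e).2 → degreeZeroMonomial a b i j e ∈ W := by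
    intro n
    induction n using Nat.strong_induction_on with
    | _ n ih =>
      intro e hen he
      by_cases hsmall : ∀ l, e l ≤ 2
      · exact hW e hsmall he
      push Not at hsmall
      obtain ⟨l, hl⟩ := hsmall
      have hle : Finsupp.single l 2 ≤ e := by
        rw [Finsupp.single_le_iff]
        omega
      obtain ⟨e', rfl⟩ := exists_add_of_le hle
      have h2 : 2 ∣ (Finsupp.weight (weights a b) (Finsupp.single l 2)).2 := by
        rw [Finsupp.weight_single]
        exact ⟨(weights a b l).2, by simp⟩
      rw [map_add, Prod.snd_add] at he
      have h3 := (Int.dvd_add_right h2).mp he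
      have hmul : degreeZeroMonomial a b i j (Finsupp.single l 2 + e') =
          degreeZeroMonomial a b i j (Finsupp.single l 2) * degreeZeroMonomial a b i j e' := by
        unfold degreeZeroMonomial
        rw [map_add, laurent_add a b i j (hbj.trans h2), div_mul_div_comm, ← map_mul,
          monomial_mul, one_mul]
      rw [hmul]
      refine mul_mem (hW _ (fun l' => ?_) h2) (ih _ ?_ e' rfl h3)
      · rw [Finsupp.single_apply]
        split_ifs <;> simp
      · rw [← hen, map_add, Finsupp.degree_single]
        omega
  have hsum : algebraMap Cox CoxField p / laurent a b i j d =
      ∑ e ∈ p.support, coeff e p • degreeZeroMonomial a b i j e := by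
    conv_lhs => rw [p.as_sum, map_sum, Finset.sum_div]
    refine Finset.sum_congr rfl fun e he => ?_
    rw [degreeZeroMonomial, hp (mem_support_iff.mp he), ← smul_div_assoc]
    congr 1
    rw [← algebraMap_smul Cox (coeff e p) (algebraMap Cox CoxField (monomial e 1)),
      Algebra.smul_def, ← map_mul, algebraMap_eq, C_mul_monomial, mul_one]
  rw [hsum]
  refine sum_mem fun e he => W.smul_mem (hmon _ e rfl ?_) _
  rw [hp (mem_support_iff.mp he)]
  exact hd

end

/-- The function field of a subvariety is generated by the finitely many degree zero monomials with
small exponents: a fraction `p / q` equals `p q / L` divided by `q ^ 2 / L`, for a Laurent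
monomial `L` with even weight. -/
theorem essFiniteType_fieldOf {a b : Fin 4 → ℕ} (hb : ∀ j, b j ∣ 2)
    (Z : IrreducibleCloseds (Variety (weights a b))) : Algebra.EssFiniteType ℂ (fieldOf Z) := by
  classical
  obtain ⟨x, hx⟩ := Z.isIrreducible'.1
  obtain ⟨z, rfl⟩ := quot_surjective _ x
  obtain ⟨⟨i, hi⟩, j, hj⟩ := mem_coxOpen_iff.mp z.2
  have hbj : (b j : ℤ) ∣ 2 := by exact_mod_cast hb j
  have hbj0 : b j ≠ 0 := fun h => by simpa [h] using hb j
  set A := localRing (weights a b) (Z : Set (Variety (weights a b))) Z.isIrreducible'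
  let res : A →ₐ[ℂ] fieldOf Z := IsScalarTower.toAlgHom ℂ A (fieldOf Z)
  set E : Set (Var →₀ ℕ) := {e | ∀ l, e l ≤ 2}
  have hE : E.Finite := (Set.finite_Icc 0 (Finsupp.equivFunOnFinite.symm fun _ : Var => 2)).subset
    fun e he => ⟨zero_le, fun l => he l⟩
  set S : Set (fieldOf Z) := (fun e => if h : degreeZeroMonomial a b i j e ∈ A then
    res ⟨_, h⟩ else 0) '' E
  set F := IntermediateField.adjoin ℂ S
  let W : Subalgebra ℂ CoxField := (F.toSubalgebra.comap res).map A.val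
  have hWF : ∀ {α : CoxField}, α ∈ W → ∃ h : α ∈ A, res ⟨α, h⟩ ∈ F := by
    rintro _ ⟨α, hα, rfl⟩
    exact ⟨α.2, hα⟩
  have hW : ∀ {p : Cox} {d : ℤ × ℤ}, IsWeightedHomogeneous (weights a b) p d → 2 ∣ d.2 →
      algebraMap Cox CoxField p / laurent a b i j d ∈ W := by
    intro p d hp hd
    refine div_laurent_mem_of_forall_le hb W (fun e he h2 => ?_) hp hd
    have hmem : degreeZeroMonomial a b i j e ∈ A :=
      div_laurent_mem_localRing Z.isIrreducible' hx hi hj hbj0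
        (isWeightedHomogeneous_monomial _ e 1 rfl) (hbj.trans h2)
    refine ⟨⟨_, hmem⟩, IntermediateField.subset_adjoin ℂ S ⟨e, he, ?_⟩, rfl⟩
    change dite _ _ _ = _
    rw [dif_pos hmem]
    rfl
  -- even weights are multiples of `b j`, so the Laurent monomials below have honest exponents
  have htop : F = ⊤ := by
    refine eq_top_iff.mpr fun y _ => ?_
    obtain ⟨φ, rfl⟩ := IsLocalRing.residue_surjective y
    obtain ⟨φ, d, p, q, hp, hq, hqZ, rfl⟩ := φ
    have hL := laurent_ne_zero a b i j (d + d)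
    have hq0 := ne_zero_of_nonvanishing hqZ
    have h2 : 2 ∣ (d + d).2 := ⟨d.2, by rw [Prod.snd_add]; ring⟩
    obtain ⟨hα, hαF⟩ := hWF (hW (hp.mul hq) h2)
    obtain ⟨hβ, hβF⟩ := hWF (hW (hq.mul hq) h2)
    have hβ' := laurent_div_mem_localRing Z.isIrreducible' hx hi hj hbj0 (hq.mul hq)
      (nonvanishing_mul Z.isIrreducible' hq hq hqZ hqZ) (hbj.trans h2)
    have hqq : algebraMap Cox CoxField (q * q) ≠ 0 := by
      rw [map_mul]
      exact mul_ne_zero hq0 hq0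
    have hunit : IsUnit (⟨_, hβ⟩ : A) := IsUnit.of_mul_eq_one ⟨_, hβ'⟩ (Subtype.ext (by
      change _ / _ * (_ / _) = (1 : CoxField)
      rw [div_mul_div_comm, mul_comm]
      exact div_self (mul_ne_zero hL hqq)))
    have hne : res ⟨_, hβ⟩ ≠ 0 := (hunit.map res).ne_zero
    have hprod : ∀ hφ : algebraMap Cox CoxField p / algebraMap Cox CoxField q ∈ A,
        res ⟨_, hφ⟩ * res ⟨_, hβ⟩ = res ⟨_, hα⟩ := by
      intro hφ
      rw [← map_mul]
      congr 1
      refine Subtype.ext ?_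
      change _ / _ * (_ / _) = _ / _
      rw [map_mul, map_mul]
      field_simp
    have := div_mem hαF hβF
    rwa [← hprod ⟨d, p, q, hp, hq, hqZ, rfl⟩, mul_div_cancel_right₀ _ hne] at this
  rw [← IntermediateField.fg_top_iff, ← htop]
  exact IntermediateField.fg_adjoin_of_finite (hE.image _)

/-! ### Principal divisors are numerically trivial -/

section

variable {a b : Fin 4 → ℕ} {j₁ j₂ : Fin 4}

lemma IsLocalEquation.div_mem_localRing (hj : j₁ ≠ j₂) (h₁ : b j₁ = 1) (h₂ : b j₂ = 1)
    {D : WeilDivisor (weights a b)} {f : CoxField} (hf : f ∈ functionField (weights a b))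
    (hf0 : f ≠ 0) (hD : ∀ P : PrimeDivisor (weights a b), D P = P.ord f)
    {Z : Set (Variety (weights a b))} (hZ : IsIrreducible Z) {m : ℕ} {g : CoxField}
    (hg : IsLocalEquation (m • D) Z g) :
    f ^ m / g ∈ localRing (weights a b) Z hZ ∧ g / f ^ m ∈ localRing (weights a b) Z hZ := by
  obtain ⟨hg, hg0, hgD⟩ := hg
  have hfm := pow_mem hf m
  have hfm0 := pow_ne_zero m hf0
  have hord : ∀ P : PrimeDivisor (weights a b), Z ⊆ (P.1 : Set (Variety (weights a b))) →
      P.ord g = P.ord (f ^ m) := by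
    intro P hP
    rw [hgD P hP, PrimeDivisor.ord_pow hj h₁ h₂ P hf hf0]
    simp [hD]
  constructor
  · refine mem_localRing_of_forall_ord_eq_zero hj h₁ h₂ hZ (div_mem hfm hg) (div_ne_zero hfm0 hg0)
      fun P hP => ?_
    rw [div_eq_mul_inv, PrimeDivisor.ord_mul hj h₁ h₂ P hfm (inv_mem hg) hfm0 (inv_ne_zero hg0),
      PrimeDivisor.ord_inv hj h₁ h₂ P hg hg0, hord P hP, add_neg_cancel]
  · refine mem_localRing_of_forall_ord_eq_zero hj h₁ h₂ hZ (div_mem hg hfm) (div_ne_zero hg0 hfm0)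
      fun P hP => ?_
    rw [div_eq_mul_inv, PrimeDivisor.ord_mul hj h₁ h₂ P hg (inv_mem hfm) hg0 (inv_ne_zero hfm0),
      PrimeDivisor.ord_inv hj h₁ h₂ P hfm hfm0, hord P hP, add_neg_cancel]

/-- Up to units, the restriction to `C` of a local equation of `m` times the divisor of `f` at any
point is the rational function `f ^ m / h` on `C`, so the degree is that of the divisor of a
rational function on a complete curve. -/
lemma eq_zero_of_isIntersectionNumber (hj : j₁ ≠ j₂) (h₁ : b j₁ = 1) (h₂ : b j₂ = 1)
    (hb : ∀ j, b j ∣ 2) {D : WeilDivisor (weights a b)} {f : CoxField}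
    (hf : f ∈ functionField (weights a b)) (hf0 : f ≠ 0)
    (hD : ∀ P : PrimeDivisor (weights a b), D P = P.ord f) {C : Curve (weights a b)} {q : ℚ}
    (hq : IsIntersectionNumber D C q) : q = 0 := by
  obtain ⟨m, h, r, hm, hh, hr, hq⟩ := hq
  have hess := essFiniteType_fieldOf hb C.1
  obtain ⟨hψ, hψ'⟩ := IsLocalEquation.div_mem_localRing hj h₁ h₂ hf hf0 hD C.1.isIrreducible' hh
  have hh0 := hh.2.1
  have hfm0 := pow_ne_zero m hf0
  have hunit : IsUnit (⟨_, hψ⟩ : localRing (weights a b) (C.1 : Set (Variety (weights a b)))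
      C.1.isIrreducible') := IsUnit.of_mul_eq_one ⟨_, hψ'⟩ (Subtype.ext (by
    change _ / _ * (_ / _) = (1 : CoxField)
    field_simp))
  set t : fieldOf C.1 := IsLocalRing.residue _ ⟨_, hψ⟩
  have ht : t ≠ 0 := (hunit.map (IsLocalRing.residue _)).ne_zero
  have hord : ∀ v : C.Place, v.ord (IsLocalRing.residue _ (r v)) =
      orderAlong v.1.toSubring t := by
    intro v
    obtain ⟨x, g, ⟨hx, hv⟩, hg, hrv⟩ := hr v
    obtain ⟨hθ', hθ⟩ :=
      IsLocalEquation.div_mem_localRing hj h₁ h₂ hf hf0 hD isIrreducible_singleton hg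
    have hg0 := hg.2.1
    have hmul : C.restrict hx ⟨_, hθ⟩ * C.restrict hx ⟨_, hθ'⟩ = 1 := by
      rw [← map_mul, ← map_one (C.restrict hx)]
      congr 1
      refine Subtype.ext ?_
      change _ / _ * (_ / _) = (1 : CoxField)
      field_simp
    have hres : IsLocalRing.residue _ (r v) = C.restrict hx ⟨_, hθ⟩ * t := by
      change _ = IsLocalRing.residue _ (Subalgebra.inclusion (localRing_mono _ _
        (Set.singleton_subset_iff.mpr hx)) ⟨_, hθ⟩) * IsLocalRing.residue _ _
      rw [← map_mul]
      congr 1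
      refine Subtype.ext ?_
      change (r v : CoxField) = _ / _ * (_ / _)
      rw [hrv]
      field_simp
    rw [hres]
    refine orderAlong_unit_mul (left_ne_zero_of_mul_eq_one hmul) (hv _).1 ?_ t
    rw [inv_eq_of_mul_eq_one_right hmul]
    exact (hv _).1
  have hsum : ∑ᶠ v : C.Place, v.ord (IsLocalRing.residue _ (r v)) = 0 := by
    rw [finsum_congr hord]
    exact finsum_orderAlong_eq_zero C.2 ht
  rw [hsum, Int.cast_zero] at hq
  exact (mul_eq_zero.mp hq).resolve_left (by exact_mod_cast hm.ne')

theorem numericallyTrivial_of_principal (hj : j₁ ≠ j₂) (h₁ : b j₁ = 1) (h₂ : b j₂ = 1)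
    (hb : ∀ j, b j ∣ 2) {D : WeilDivisor (weights a b)} {f : CoxField}
    (hf : f ∈ functionField (weights a b)) (hf0 : f ≠ 0)
    (hD : ∀ P : PrimeDivisor (weights a b), D P = P.ord f) : NumericallyTrivial D := by
  intro C
  unfold intersectionNumber
  split_ifs with h
  · exact eq_zero_of_isIntersectionNumber hj h₁ h₂ hb hf hf0 hD h.choose_spec
  · rfl

end

/-! ### Classes of prime divisors -/

section

variable {w : Var → ℤ × ℤ}

/-- The class map as an additive homomorphism. -/
noncomputable def numClassHom (w : Var → ℤ × ℤ) : WeilDivisor w →+ N1 w where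
  toFun := WeilDivisor.numClass
  map_zero' := congrArg (Submodule.mkQ _) Finsupp.mapRange_zero
  map_add' D E := (congrArg (Submodule.mkQ _) (Finsupp.mapRange_add (by simp) D E)).trans
    (map_add (Submodule.mkQ _) D.toReal E.toReal)

lemma numClass_eq_sum (D : WeilDivisor w) :
    D.numClass = D.sum fun P n => (n : ℝ) • P.numClass := by
  have hsingle : ∀ (P : PrimeDivisor w) (n : ℤ),
      WeilDivisor.numClass (Finsupp.single P n) = (n : ℝ) • P.numClass := by
    intro P n
    rw [Int.cast_smul_eq_zsmul ℝ n]
    change numClassHom w _ = n • numClassHom w _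
    rw [← map_zsmul]
    simp
  conv_lhs => rw [← D.sum_single]
  change numClassHom w _ = _
  rw [Finsupp.sum, map_sum]
  exact Finset.sum_congr rfl fun P _ => hsingle P _

lemma numClass_eq_zero {D : WeilDivisor w} (hD : NumericallyTrivial D) : D.numClass = 0 :=
  (Submodule.Quotient.mk_eq_zero _).mpr (Submodule.subset_span ⟨D, hD, rfl⟩)

end

/-! ### Cones generated by two vectors are closed -/

section ClosedCones

lemma PointedCone.mem_hull_pair {V : Type*} [AddCommGroup V] [Module ℝ V] {x y z : V} :
    z ∈ PointedCone.hull ℝ {x, y} ↔ ∃ s t : ℝ, 0 ≤ s ∧ 0 ≤ t ∧ s • x + t • y = z := by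
  rw [Submodule.mem_span_pair]
  constructor
  · rintro ⟨s, t, rfl⟩
    exact ⟨s, t, s.2, t.2, rfl⟩
  · rintro ⟨s, t, hs, ht, rfl⟩
    exact ⟨⟨s, hs⟩, ⟨t, ht⟩, rfl⟩

variable {V : Type*} [AddCommGroup V] [Module ℝ V] [TopologicalSpace V] [IsModuleTopology ℝ V]

/-- A subspace is an intersection of kernels of linear forms, which are continuous for the module
topology. -/
lemma Submodule.isClosed_of_isModuleTopology (S : Submodule ℝ V) : IsClosed (S : Set V) := by
  have : (S : Set V) = ⋂ (f : V →ₗ[ℝ] ℝ) (_ : S ≤ LinearMap.ker f), f ⁻¹' {0} := by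
    ext z
    simp only [Set.mem_iInter, Set.mem_preimage, Set.mem_singleton_iff, SetLike.mem_coe]
    refine ⟨fun hz f hf => hf hz, fun h => ?_⟩
    by_contra hz
    obtain ⟨f, hfz, hf⟩ := S.exists_le_ker_of_notMem hz
    exact hfz (h f hf)
  rw [this]
  exact isClosed_iInter fun f => isClosed_iInter fun _ =>
    isClosed_singleton.preimage (IsModuleTopology.continuous_of_linearMap f)

lemma LinearMap.isClosed_image_of_injective {W : Type*} [AddCommGroup W] [Module ℝ W]
    [TopologicalSpace W] [IsModuleTopology ℝ W] {L : W →ₗ[ℝ] V} (hL : Function.Injective L)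
    {C : Set W} (hC : IsClosed C) : IsClosed (L '' C) := by
  have := IsModuleTopology.toContinuousAdd ℝ W
  obtain ⟨f, hf⟩ := L.exists_leftInverse_of_injective (LinearMap.ker_eq_bot.mpr hL)
  have hfL : ∀ c, f (L c) = c := fun c => LinearMap.congr_fun hf c
  have : L '' C = (LinearMap.range L : Set V) ∩ f ⁻¹' C := by
    ext z
    constructor
    · rintro ⟨c, hc, rfl⟩
      exact ⟨⟨c, rfl⟩, by rwa [Set.mem_preimage, hfL]⟩
    · rintro ⟨⟨c, rfl⟩, hc⟩
      exact ⟨c, by rwa [Set.mem_preimage, hfL] at hc, rfl⟩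
  rw [this]
  exact (Submodule.isClosed_of_isModuleTopology _).inter
    (hC.preimage (IsModuleTopology.continuous_of_linearMap f))

lemma PointedCone.isClosed_hull_pair_smul (x : V) (c : ℝ) :
    IsClosed (PointedCone.hull ℝ {x, c • x} : Set V) := by
  by_cases hc : x ≠ 0 ∧ 0 ≤ c
  · obtain ⟨hx, hc⟩ := hc
    convert LinearMap.isClosed_image_of_injective (L := LinearMap.toSpanSingleton ℝ V x)
      (smul_left_injective ℝ hx) (isClosed_Ici (a := (0 : ℝ))) using 1
    ext z
    simp only [SetLike.mem_coe, PointedCone.mem_hull_pair, Set.mem_image, Set.mem_Ici,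
      LinearMap.toSpanSingleton_apply]
    constructor
    · rintro ⟨s, t, hs, ht, rfl⟩
      exact ⟨s + t * c, by positivity, by module⟩
    · rintro ⟨s, hs, rfl⟩
      exact ⟨s, 0, hs, le_rfl, by module⟩
  -- in the remaining case the cone is a line or zero
  · convert Submodule.isClosed_of_isModuleTopology (Submodule.span ℝ {x}) using 1
    ext z
    simp only [SetLike.mem_coe, PointedCone.mem_hull_pair, Submodule.mem_span_singleton]
    constructor
    · rintro ⟨s, t, -, -, rfl⟩
      exact ⟨s + t * c, by module⟩
    · rintro ⟨r, rfl⟩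
      by_cases hx : x = 0
      · exact ⟨0, 0, le_rfl, le_rfl, by simp [hx]⟩
      have hc' : c < 0 := by
        by_contra h
        exact hc ⟨hx, not_lt.mp h⟩
      rcases le_total 0 r with hr | hr
      · exact ⟨r, 0, hr, le_rfl, by module⟩
      · refine ⟨0, r / c, le_rfl, div_nonneg_of_nonpos hr hc'.le, ?_⟩
        rw [zero_smul, zero_add, smul_smul, div_mul_cancel₀ _ hc'.ne]

theorem PointedCone.isClosed_hull_pair (x y : V) :
    IsClosed (PointedCone.hull ℝ {x, y} : Set V) := by
  by_cases hli : LinearIndependent ℝ ![x, y]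
  · rw [LinearIndependent.pair_iff] at hli
    let L : ℝ × ℝ →ₗ[ℝ] V :=
      (LinearMap.toSpanSingleton ℝ V x).coprod (LinearMap.toSpanSingleton ℝ V y)
    have hL : Function.Injective L := by
      rw [← LinearMap.ker_eq_bot, LinearMap.ker_eq_bot']
      rintro ⟨s, t⟩ h
      obtain ⟨rfl, rfl⟩ := hli s t h
      rfl
    convert LinearMap.isClosed_image_of_injective hL (isClosed_Ici (a := (0 : ℝ × ℝ))) using 1
    ext z
    rw [SetLike.mem_coe, PointedCone.mem_hull_pair]
    constructor
    · rintro ⟨s, t, hs, ht, rfl⟩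
      exact ⟨(s, t), ⟨hs, ht⟩, rfl⟩
    · rintro ⟨⟨s, t⟩, ⟨hs, ht⟩, rfl⟩
      exact ⟨s, t, hs, ht, rfl⟩
  · rw [LinearIndependent.pair_iff] at hli
    push Not at hli
    obtain ⟨s, t, hst, h⟩ := hli
    by_cases ht : t = 0
    · have hs : s ≠ 0 := fun hs => h hs ht
      have hx : x = (0 : ℝ) • y := by
        rw [ht, zero_smul, add_zero] at hst
        rw [zero_smul]
        exact (smul_eq_zero.mp hst).resolve_left hs
      rw [hx, Set.pair_comm]
      exact PointedCone.isClosed_hull_pair_smul y 0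
    · have hy : y = (-(s / t)) • x := by
        have : t • y = t • ((-(s / t)) • x) := by
          rw [smul_smul, mul_neg, mul_div_cancel₀ _ ht, neg_smul]
          exact eq_neg_of_add_eq_zero_right hst
        exact smul_right_injective V ht this
      rw [hy]
      exact PointedCone.isClosed_hull_pair_smul x _

end ClosedCones

/-! ### Relations between the classes of prime divisors -/

section Relations

lemma vanishingDivisor_eq_of_dvd {w : Var → ℤ × ℤ} {p q : Cox} {d e : ℤ × ℤ}
    (hp : IsWeightedHomogeneous w p d) (hirr : Irreducible p)
    (hq : IsWeightedHomogeneous w q e) (hqirr : Irreducible q) (h : q ∣ p) :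
    vanishingDivisor hq hqirr = vanishingDivisor hp hirr := by
  refine Subtype.ext (IrreducibleCloseds.ext ?_)
  exact Set.Subset.antisymm ((vanishing_subset_iff hq hp hqirr).mpr h)
    ((vanishing_subset_iff hp hq hirr).mpr (hqirr.associated_of_dvd hirr h).symm.dvd)

lemma multiplicity_eq_single {w : Var → ℤ × ℤ} {p q : Cox} {d e : ℤ × ℤ}
    (hp : IsWeightedHomogeneous w p d) (hirr : Irreducible p)
    (hq : IsWeightedHomogeneous w q e) (hqirr : Irreducible q) :
    (multiplicity q p : ℤ) =
      (Finsupp.single (vanishingDivisor hp hirr) 1 : WeilDivisor w)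
        (vanishingDivisor hq hqirr) := by
  classical
  by_cases h : q ∣ p
  · rw [vanishingDivisor_eq_of_dvd hp hirr hq hqirr h, Finsupp.single_eq_same,
      multiplicity_eq_of_associated_right (hqirr.associated_of_dvd hirr h).symm,
      _root_.multiplicity_self]
    rfl
  · rw [multiplicity_eq_zero.mpr h, Finsupp.single_eq_of_ne, Nat.cast_zero]
    intro heq
    exact h ((vanishing_subset_iff hq hp hqirr).mp
      (congrArg (fun P : PrimeDivisor w => (P.1 : Set (Variety w))) heq).subset)

variable {a b : Fin 4 → ℕ} {j₁ j₂ : Fin 4} {ι : Type*} [Fintype ι] {p : ι → Cox}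
  {d : ι → ℤ × ℤ}

/-- Two products of irreducible homogeneous polynomials of the same weight define linearly
equivalent divisors. -/
lemma exists_ord_eq_sum_single (hj : j₁ ≠ j₂) (h₁ : b j₁ = 1) (h₂ : b j₂ = 1)
    (hp : ∀ i, IsWeightedHomogeneous (weights a b) (p i) (d i)) (hirr : ∀ i, Irreducible (p i))
    {k k' : ι → ℕ} (h : ∑ i, k i • d i = ∑ i, k' i • d i) :
    ∃ f ∈ functionField (weights a b), f ≠ 0 ∧ ∀ Q : PrimeDivisor (weights a b),
      (∑ i, ((k i : ℤ) - k' i) • Finsupp.single (vanishingDivisor (hp i) (hirr i)) (1 : ℤ)) Q =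
        Q.ord f := by
  classical
  have hom : ∀ k : ι → ℕ, IsWeightedHomogeneous (weights a b) (∏ i, p i ^ k i)
      (∑ i, k i • d i) := fun k => IsWeightedHomogeneous.prod _ _ _ fun i _ => (hp i).pow (k i)
  have ne0 : ∀ k : ι → ℕ, ∏ i, p i ^ k i ≠ 0 := fun k =>
    Finset.prod_ne_zero_iff.mpr fun i _ => pow_ne_zero _ (hirr i).ne_zero
  refine ⟨algebraMap Cox CoxField (∏ i, p i ^ k i) / algebraMap Cox CoxField (∏ i, p i ^ k' i),
    ⟨_, _, _, hom k, h ▸ hom k', ne0 k', rfl⟩,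
    div_ne_zero (algebraMap_ne_zero (ne0 k)) (algebraMap_ne_zero (ne0 k')), fun Q => ?_⟩
  obtain ⟨q, e, hq, hqirr, hQ⟩ := PrimeDivisor.exists_eq_vanishing Q
  have hQ' : Q = vanishingDivisor hq hqirr := Subtype.ext (IrreducibleCloseds.ext hQ)
  have hmult : ∀ k : ι → ℕ, (multiplicity q (∏ i, p i ^ k i) : ℤ) =
      ∑ i, (k i : ℤ) * multiplicity q (p i) := by
    intro k
    have hfin : ∀ s : Finset ι, FiniteMultiplicity q (∏ i ∈ s, p i ^ k i) := fun s =>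
      FiniteMultiplicity.of_prime_left hqirr.prime
        (Finset.prod_ne_zero_iff.mpr fun i _ => pow_ne_zero _ (hirr i).ne_zero)
    induction (Finset.univ : Finset ι) using Finset.induction_on with
    | empty => simpa using multiplicity_eq_zero.mpr fun h => hqirr.not_isUnit (isUnit_of_dvd_one h)
    | insert i s hi ih =>
      have := hfin (insert i s)
      rw [Finset.prod_insert hi] at this
      rw [Finset.prod_insert hi, Finset.sum_insert hi, multiplicity_mul hqirr.prime this,
        FiniteMultiplicity.multiplicity_pow hqirr.prime
          (FiniteMultiplicity.of_prime_left hqirr.prime (hirr i).ne_zero), ← ih]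
      push_cast
      rfl
  rw [PrimeDivisor.ord_div hj h₁ h₂ Q hq hqirr hQ (hom k) (h ▸ hom k') (ne0 k) (ne0 k'),
    hmult, hmult, ← Finset.sum_sub_distrib, Finsupp.finsetSum_apply]
  refine Finset.sum_congr rfl fun i _ => ?_
  rw [Finsupp.smul_apply, hQ', ← multiplicity_eq_single, smul_eq_mul]
  ring

lemma sum_smul_numClass_eq (hj : j₁ ≠ j₂) (h₁ : b j₁ = 1) (h₂ : b j₂ = 1) (hb : ∀ j, b j ∣ 2)
    (hp : ∀ i, IsWeightedHomogeneous (weights a b) (p i) (d i)) (hirr : ∀ i, Irreducible (p i))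
    {k k' : ι → ℕ} (h : ∑ i, k i • d i = ∑ i, k' i • d i) :
    ∑ i, (k i : ℝ) • (vanishingDivisor (hp i) (hirr i)).numClass =
      ∑ i, (k' i : ℝ) • (vanishingDivisor (hp i) (hirr i)).numClass := by
  obtain ⟨f, hf, hf0, hfQ⟩ := exists_ord_eq_sum_single hj h₁ h₂ hp hirr h
  have h0 := numClass_eq_zero (numericallyTrivial_of_principal hj h₁ h₂ hb hf hf0 hfQ)
  change numClassHom _ _ = 0 at h0
  rw [map_sum] at h0
  rw [← sub_eq_zero, ← Finset.sum_sub_distrib, ← h0]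
  refine Finset.sum_congr rfl fun i _ => ?_
  rw [map_zsmul, ← sub_smul, ← Int.cast_smul_eq_zsmul ℝ]
  push_cast
  rfl

/-- The prime divisor where a Cox coordinate vanishes. -/
noncomputable def coordinateDivisor (w : Var → ℤ × ℤ) (l : Var) : PrimeDivisor w :=
  vanishingDivisor (isWeightedHomogeneous_X ℂ w l) X_prime.irreducible

lemma coordinateDivisor_coe (w : Var → ℤ × ℤ) (l : Var) :
    ((coordinateDivisor w l).1 : Set (Variety w)) = coordinateLocus w l := by
  ext x
  obtain ⟨z, rfl⟩ := quot_surjective w x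
  change quot w z ∈ vanishing w (X l) ↔ _
  constructor
  · intro h
    rw [quot_mem_vanishing (isWeightedHomogeneous_X ℂ w l), eval_X] at h
    exact ⟨z, rfl, h⟩
  · rintro ⟨z', hz', h⟩
    rw [← hz', quot_mem_vanishing (isWeightedHomogeneous_X ℂ w l), eval_X]
    exact h

lemma coordinateDivisor_injective (w : Var → ℤ × ℤ) :
    Function.Injective (coordinateDivisor w) := by
  intro l l' h
  have := (vanishing_subset_iff (isWeightedHomogeneous_X ℂ w l) (isWeightedHomogeneous_X ℂ w l')
    X_prime.irreducible).mp
      (congrArg (fun P : PrimeDivisor w => (P.1 : Set (Variety w))) h).subset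
  exact X_dvd_X.mp this

/-- The class of a prime divisor is the class of the divisor of any monomial in its equation. -/
lemma vanishingDivisor_numClass_eq_sum (hj : j₁ ≠ j₂) (h₁ : b j₁ = 1) (h₂ : b j₂ = 1)
    (hb : ∀ j, b j ∣ 2) {p : Cox} {d : ℤ × ℤ} (hp : IsWeightedHomogeneous (weights a b) p d)
    (hirr : Irreducible p) {e : Var →₀ ℕ} (he : e ∈ p.support) :
    (vanishingDivisor hp hirr).numClass =
      ∑ l, (e l : ℝ) • (coordinateDivisor (weights a b) l).numClass := by
  -- the relation between `p` and the coordinates, indexed by `none` and by the variables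
  let q : Option Var → Cox := fun o => o.elim p X
  let f : Option Var → ℤ × ℤ := fun o => o.elim d (weights a b)
  have hq : ∀ o, IsWeightedHomogeneous (weights a b) (q o) (f o) := by
    rintro (_ | l)
    · exact hp
    · exact isWeightedHomogeneous_X ℂ _ l
  have hqirr : ∀ o, Irreducible (q o) := by
    rintro (_ | l)
    · exact hirr
    · exact X_prime.irreducible
  have hd : d = ∑ l, e l • weights a b l := by
    rw [← hp (mem_support_iff.mp he), Finsupp.weight_apply, Finsupp.sum_fintype _ _ (by simp)]
  have := sum_smul_numClass_eq hj h₁ h₂ hb hq hqirr (k := fun o => o.elim 1 fun _ => 0)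
    (k' := fun o => o.elim 0 fun l => e l) (by
      simpa [Fintype.sum_option, f] using hd)
  simp only [Fintype.sum_option, Option.elim, Nat.cast_one, Nat.cast_zero, one_smul, zero_smul,
    Finset.sum_const_zero, add_zero, zero_add] at this
  exact this

end Relations

/-! ### The pseudo-effective and the mobile cone -/

section Cones

variable {a b : Fin 4 → ℕ} {j₁ j₂ : Fin 4}

lemma sum_smul_coordinateDivisor_numClass_eq (hj : j₁ ≠ j₂) (h₁ : b j₁ = 1) (h₂ : b j₂ = 1)
    (hb : ∀ j, b j ∣ 2) {k k' : Var → ℕ}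
    (h : ∑ l, k l • weights a b l = ∑ l, k' l • weights a b l) :
    ∑ l, (k l : ℝ) • (coordinateDivisor (weights a b) l).numClass =
      ∑ l, (k' l : ℝ) • (coordinateDivisor (weights a b) l).numClass :=
  sum_smul_numClass_eq hj h₁ h₂ hb _ _ h

/-- The relation between the weights of `x_l`, `x_n` and `u`, where the ratio weight of `x_n` is the
smaller one. The hypothesis makes the subtraction of natural numbers honest. -/
lemma smul_weights_inr {l n : Fin 4} (h : b n * a l ≤ b l * a n) :
    b n • weights a b (Sum.inr l) =
      b l • weights a b (Sum.inr n) + (b l * a n - b n * a l) • weights a b (Sum.inl 0) := by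
  ext
  · simp only [weights, Prod.fst_add, Prod.smul_mk, nsmul_eq_mul, Nat.cast_sub h]
    push_cast
    ring
  · simp [weights, mul_comm]

lemma coordinateDivisor_inl_numClass (hj : j₁ ≠ j₂) (h₁ : b j₁ = 1) (h₂ : b j₂ = 1)
    (hb : ∀ j, b j ∣ 2) (i : Fin 2) :
    (coordinateDivisor (weights a b) (Sum.inl i)).numClass =
      (coordinateDivisor (weights a b) (Sum.inl 0)).numClass := by
  have := sum_smul_coordinateDivisor_numClass_eq hj h₁ h₂ hb (a := a)
    (k := Pi.single (Sum.inl i) 1) (k' := Pi.single (Sum.inl 0) 1)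
    (by simp [Pi.single_apply, ite_smul, weights])
  simpa [Pi.single_apply, ite_smul] using this

/-- The class of `D_l` lies in the cone of `D_u` and `D_n` if the ratio weight of `x_n` is at most
that of `x_l`. -/
lemma coordinateDivisor_inr_mem_hull (hj : j₁ ≠ j₂) (h₁ : b j₁ = 1) (h₂ : b j₂ = 1)
    (hb : ∀ j, b j ∣ 2) {l n : Fin 4} (h : b n * a l ≤ b l * a n) :
    (coordinateDivisor (weights a b) (Sum.inr l)).numClass ∈
      PointedCone.hull ℝ {(coordinateDivisor (weights a b) (Sum.inl 0)).numClass,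
        (coordinateDivisor (weights a b) (Sum.inr n)).numClass} := by
  have hbn : (b n : ℝ) ≠ 0 := by
    have : b n ≠ 0 := fun h => by simpa [h] using hb n
    exact_mod_cast this
  have := sum_smul_coordinateDivisor_numClass_eq hj h₁ h₂ hb (a := a)
    (k := Pi.single (Sum.inr l) (b n))
    (k' := Pi.single (Sum.inr n) (b l) + Pi.single (Sum.inl 0) (b l * a n - b n * a l))
    (by simpa [Pi.single_apply, ite_smul, add_smul, Finset.sum_add_distrib] using
      smul_weights_inr h)
  rw [PointedCone.mem_hull_pair]
  refine ⟨(b l * a n - b n * a l : ℕ) / b n, b l / b n, by positivity, by positivity, ?_⟩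
  refine smul_right_injective _ hbn ?_
  simp only [Pi.single_apply, Pi.add_apply, Nat.cast_add, Nat.cast_ite, Nat.cast_zero, ite_smul,
    zero_smul, add_smul, Finset.sum_add_distrib, Finset.sum_ite_eq', Finset.mem_univ,
    if_true] at this
  change (b n : ℝ) • _ = (b n : ℝ) • _
  rw [this, smul_add, smul_smul, smul_smul, mul_div_cancel₀ _ hbn, mul_div_cancel₀ _ hbn, add_comm]

/-- The class of a prime divisor lies in the cone of `D_u` and `D_n` as soon as its equation has a
monomial in coordinates whose ratio weights are at least that of `x_n`. -/
lemma vanishingDivisor_numClass_mem_hull (hj : j₁ ≠ j₂) (h₁ : b j₁ = 1) (h₂ : b j₂ = 1)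
    (hb : ∀ j, b j ∣ 2) {p : Cox} {d : ℤ × ℤ} (hp : IsWeightedHomogeneous (weights a b) p d)
    (hirr : Irreducible p) {e : Var →₀ ℕ} (he : e ∈ p.support) {n : Fin 4}
    (h : ∀ l, e (Sum.inr l) ≠ 0 → b n * a l ≤ b l * a n) :
    (vanishingDivisor hp hirr).numClass ∈
      PointedCone.hull ℝ {(coordinateDivisor (weights a b) (Sum.inl 0)).numClass,
        (coordinateDivisor (weights a b) (Sum.inr n)).numClass} := by
  rw [vanishingDivisor_numClass_eq_sum hj h₁ h₂ hb hp hirr he]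
  refine sum_mem fun l _ => ?_
  rcases l with i | l
  · rw [coordinateDivisor_inl_numClass hj h₁ h₂ hb i]
    exact PointedCone.smul_mem _ (Nat.cast_nonneg _)
      (PointedCone.subset_hull (Set.mem_insert _ _))
  · by_cases h0 : e (Sum.inr l) = 0
    · rw [h0, Nat.cast_zero, zero_smul]
      exact zero_mem _
    · exact PointedCone.smul_mem _ (Nat.cast_nonneg _)
        (coordinateDivisor_inr_mem_hull hj h₁ h₂ hb (h l h0))

lemma numClass_mem_of_forall {w : Var → ℤ × ℤ} {D : WeilDivisor w} (hD : 0 ≤ D)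
    {C : PointedCone ℝ (N1 w)} (h : ∀ P, D P ≠ 0 → P.numClass ∈ C) : D.numClass ∈ C := by
  rw [numClass_eq_sum]
  exact sum_mem fun P hP => C.smul_mem (by exact_mod_cast hD P)
    (h P (Finsupp.mem_support_iff.mp hP))

lemma single_nonneg {w : Var → ℤ × ℤ} (P : PrimeDivisor w) {n : ℤ} (hn : 0 ≤ n) :
    (0 : WeilDivisor w) ≤ Finsupp.single P n := by
  intro Q
  classical
  rw [Finsupp.single_apply]
  split_ifs <;> simp [hn]

/-- The class of an effective divisor lies in the cone of `D_u` and `D_4`, because `x_4` has the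
smallest ratio weight. -/
lemma numClass_mem_hull_of_effective (hj : j₁ ≠ j₂) (h₁ : b j₁ = 1) (h₂ : b j₂ = 1)
    (hb : ∀ j, b j ∣ 2) (hab : ∀ l, b 3 * a l ≤ b l * a 3)
    {D : WeilDivisor (weights a b)} (hD : 0 ≤ D) :
    D.numClass ∈ PointedCone.hull ℝ {(coordinateDivisor (weights a b) (Sum.inl 0)).numClass,
        (coordinateDivisor (weights a b) (Sum.inr 3)).numClass} := by
  refine numClass_mem_of_forall hD fun P _ => ?_
  obtain ⟨p, d, hp, hirr, hP⟩ := PrimeDivisor.exists_eq_vanishing P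
  obtain rfl : P = vanishingDivisor hp hirr := Subtype.ext (IrreducibleCloseds.ext hP)
  obtain ⟨e, he⟩ := support_nonempty.mpr hirr.ne_zero
  exact vanishingDivisor_numClass_mem_hull hj h₁ h₂ hb hp hirr he fun l _ => hab l

/-- An equation of a prime divisor other than `D_4` has a monomial without `x_4`. -/
lemma numClass_mem_hull_of_apply_eq_zero (hj : j₁ ≠ j₂) (h₁ : b j₁ = 1) (h₂ : b j₂ = 1)
    (hb : ∀ j, b j ∣ 2) (hab : ∀ l, l ≠ 3 → b 2 * a l ≤ b l * a 2)
    {D : WeilDivisor (weights a b)} (hD : 0 ≤ D)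
    (hD3 : D (coordinateDivisor (weights a b) (Sum.inr 3)) = 0) :
    D.numClass ∈ PointedCone.hull ℝ {(coordinateDivisor (weights a b) (Sum.inl 0)).numClass,
        (coordinateDivisor (weights a b) (Sum.inr 2)).numClass} := by
  refine numClass_mem_of_forall hD fun P hDP => ?_
  obtain ⟨p, d, hp, hirr, hP⟩ := PrimeDivisor.exists_eq_vanishing P
  obtain rfl : P = vanishingDivisor hp hirr := Subtype.ext (IrreducibleCloseds.ext hP)
  obtain ⟨e, he, he3⟩ : ∃ e ∈ p.support, e (Sum.inr 3) = 0 := by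
    by_contra hcon
    push Not at hcon
    have hdvd : X (Sum.inr 3) ∣ p := by
      rw [p.as_sum]
      exact Finset.dvd_sum fun e he => X_dvd_monomial.mpr (Or.inr (hcon e he))
    apply hDP
    rw [← vanishingDivisor_eq_of_dvd hp hirr (isWeightedHomogeneous_X ℂ (weights a b) (Sum.inr 3))
      X_prime.irreducible hdvd]
    exact hD3
  refine vanishingDivisor_numClass_mem_hull hj h₁ h₂ hb hp hirr he fun l hl => hab l ?_
  rintro rfl
  exact hl he3

/-- A multiple of a mobile divisor is linearly equivalent to an effective divisor without `D_4`. -/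
lemma numClass_mem_hull_of_isMobile (hj : j₁ ≠ j₂) (h₁ : b j₁ = 1) (h₂ : b j₂ = 1)
    (hb : ∀ j, b j ∣ 2) (hab : ∀ l, l ≠ 3 → b 2 * a l ≤ b l * a 2)
    {D : WeilDivisor (weights a b)} (hD : IsMobile D) :
    D.numClass ∈ PointedCone.hull ℝ {(coordinateDivisor (weights a b) (Sum.inl 0)).numClass,
        (coordinateDivisor (weights a b) (Sum.inr 2)).numClass} := by
  obtain ⟨m, hm, -, hmob⟩ := hD
  obtain ⟨E, ⟨hE, f, hf, hf0, hfE⟩, hE3⟩ := hmob (coordinateDivisor (weights a b) (Sum.inr 3))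
  have hmem := numClass_mem_hull_of_apply_eq_zero hj h₁ h₂ hb hab hE hE3
  have hcls : E.numClass = (m : ℝ) • D.numClass := by
    have := numClass_eq_zero (numericallyTrivial_of_principal (D := E - m • D) hj h₁ h₂ hb hf hf0
      hfE)
    change numClassHom _ _ = 0 at this
    rw [map_sub, map_nsmul, sub_eq_zero, ← Nat.cast_smul_eq_nsmul ℝ] at this
    exact this
  have hm0 : (m : ℝ) ≠ 0 := by exact_mod_cast hm.ne'
  have := PointedCone.smul_mem _ (show 0 ≤ (m : ℝ)⁻¹ by positivity) hmem
  rwa [hcls, inv_smul_smul₀ hm0] at this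

lemma self_mem_linearSystem {w : Var → ℤ × ℤ} {D : WeilDivisor w} (hD : 0 ≤ D) :
    D ∈ linearSystem D :=
  ⟨hD, 1, one_mem _, one_ne_zero, fun P => by rw [sub_self, PrimeDivisor.ord_one P]⟩

/-- The linear system of `D_u` contains `D_u` and `D_v`. -/
lemma isMobile_single_inl (hj : j₁ ≠ j₂) (h₁ : b j₁ = 1) (h₂ : b j₂ = 1) :
    IsMobile (Finsupp.single (coordinateDivisor (weights a b) (Sum.inl 0)) 1 :
      WeilDivisor (weights a b)) := by
  classical
  have hself := self_mem_linearSystem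
    (single_nonneg (coordinateDivisor (weights a b) (Sum.inl 0)) zero_le_one)
  refine ⟨1, one_pos, ?_, fun P => ?_⟩
  · rw [one_smul]
    exact ⟨_, hself⟩
  rw [one_smul]
  by_cases hP : P = coordinateDivisor (weights a b) (Sum.inl 0)
  · refine ⟨Finsupp.single (coordinateDivisor (weights a b) (Sum.inl 1)) 1,
      ⟨single_nonneg _ zero_le_one, ?_⟩, ?_⟩
    · obtain ⟨f, hf, hf0, hfQ⟩ := exists_ord_eq_sum_single hj h₁ h₂
        (fun l => isWeightedHomogeneous_X ℂ (weights a b) l) (fun l => X_prime.irreducible)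
        (k := Pi.single (Sum.inl 1) 1) (k' := Pi.single (Sum.inl 0) 1)
        (by simp [Pi.single_apply, ite_smul, weights])
      refine ⟨f, hf, hf0, fun Q => ?_⟩
      rw [← hfQ Q, ← Finsupp.sub_apply]
      congr 1
      simp only [sub_smul, Finset.sum_sub_distrib, Pi.single_apply, Nat.cast_ite, Nat.cast_one,
        Nat.cast_zero, ite_smul, one_smul, zero_smul, Finset.sum_ite_eq', Finset.mem_univ, if_true]
      rfl
    · rw [hP]
      exact Finsupp.single_eq_of_ne fun h => by
        simpa using coordinateDivisor_injective (weights a b) h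
  · exact ⟨_, hself, Finsupp.single_eq_of_ne hP⟩

/-- The linear system of `b_4 D_3` contains `b_4 D_3` and `b_3 D_4 + c D_u` for some `c ≥ 0`. -/
lemma isMobile_single_inr (hj : j₁ ≠ j₂) (h₁ : b j₁ = 1) (h₂ : b j₂ = 1)
    (hb0 : b 3 ≠ 0) (h : b 3 * a 2 ≤ b 2 * a 3) :
    IsMobile (Finsupp.single (coordinateDivisor (weights a b) (Sum.inr 2)) 1 :
      WeilDivisor (weights a b)) := by
  classical
  have hsmul : b 3 • (Finsupp.single (coordinateDivisor (weights a b) (Sum.inr 2)) 1 :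
      WeilDivisor (weights a b)) =
      Finsupp.single (coordinateDivisor (weights a b) (Sum.inr 2)) (b 3 : ℤ) := by
    simp
  have hself := self_mem_linearSystem
    (single_nonneg (coordinateDivisor (weights a b) (Sum.inr 2)) (Nat.cast_nonneg (b 3)))
  refine ⟨b 3, Nat.pos_of_ne_zero hb0, ?_, fun P => ?_⟩
  · rw [hsmul]
    exact ⟨_, hself⟩
  rw [hsmul]
  by_cases hP : P = coordinateDivisor (weights a b) (Sum.inr 2)
  · refine ⟨Finsupp.single (coordinateDivisor (weights a b) (Sum.inr 3)) (b 2 : ℤ) +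
      Finsupp.single (coordinateDivisor (weights a b) (Sum.inl 0))
        ((b 2 * a 3 - b 3 * a 2 : ℕ) : ℤ),
      ⟨add_nonneg (single_nonneg _ (Nat.cast_nonneg _)) (single_nonneg _ (Nat.cast_nonneg _)), ?_⟩,
      ?_⟩
    · obtain ⟨f, hf, hf0, hfQ⟩ := exists_ord_eq_sum_single hj h₁ h₂
        (fun l => isWeightedHomogeneous_X ℂ (weights a b) l) (fun l => X_prime.irreducible)
        (k := Pi.single (Sum.inr 3) (b 2) + Pi.single (Sum.inl 0) (b 2 * a 3 - b 3 * a 2))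
        (k' := Pi.single (Sum.inr 2) (b 3))
        (by simpa [Pi.single_apply, ite_smul, add_smul, Finset.sum_add_distrib] using
          (smul_weights_inr h).symm)
      refine ⟨f, hf, hf0, fun Q => ?_⟩
      rw [← hfQ Q, ← Finsupp.sub_apply]
      congr 1
      simp only [sub_smul, add_smul, Finset.sum_sub_distrib, Finset.sum_add_distrib, Pi.add_apply,
        Pi.single_apply, Nat.cast_add, Nat.cast_ite, Nat.cast_zero, ite_smul, zero_smul,
        Finset.sum_ite_eq', Finset.mem_univ, if_true, Finsupp.smul_single, smul_eq_mul, mul_one]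
      rfl
    · rw [hP, Finsupp.add_apply, Finsupp.single_eq_of_ne, Finsupp.single_eq_of_ne, add_zero]
      · exact fun h => by simpa using coordinateDivisor_injective (weights a b) h
      · exact fun h => by simpa using coordinateDivisor_injective (weights a b) h
  · exact ⟨_, hself, Finsupp.single_eq_of_ne hP⟩

end Cones

lemma mul_le_mul_of_ratioWeight_le {a b : Fin 4 → ℕ} {l n : Fin 4} (hl : b l ≠ 0) (hn : b n ≠ 0)
    (h : ratioWeight a b n ≤ ratioWeight a b l) : b n * a l ≤ b l * a n := by
  have hl' : (0 : ℚ) < b l := by exact_mod_cast Nat.pos_of_ne_zero hl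
  have hn' : (0 : ℚ) < b n := by exact_mod_cast Nat.pos_of_ne_zero hn
  unfold ratioWeight at h
  rw [div_le_div_iff₀ hn' hl'] at h
  have : (b n * a l : ℚ) ≤ b l * a n := by linarith
  exact_mod_cast this

lemma exists_ne_eq_one_and_forall_dvd_two {b : Fin 4 → ℕ}
    (hb : Multiset.map b Finset.univ.val = {1, 1, 1, 2}) :
    (∃ j₁ j₂, j₁ ≠ j₂ ∧ b j₁ = 1 ∧ b j₂ = 1) ∧ ∀ j, b j ∣ 2 := by
  have hmem : ∀ j, b j = 1 ∨ b j = 2 := by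
    intro j
    have : b j ∈ Multiset.map b Finset.univ.val := Multiset.mem_map_of_mem b (Finset.mem_univ j)
    rw [hb] at this
    simpa using this
  constructor
  · have hcount : Multiset.count 1 (Multiset.map b Finset.univ.val) = 3 := by
      rw [hb]
      decide
    rw [Multiset.count_map] at hcount
    have hcard : 1 < (Finset.univ.filter fun j => 1 = b j).card := by
      change 1 < Multiset.card (Multiset.filter (fun j => 1 = b j) Finset.univ.val)
      omega
    obtain ⟨j₁, h₁, j₂, h₂, hj⟩ := Finset.one_lt_card.mp hcard
    exact ⟨j₁, j₂, hj, (Finset.mem_filter.mp h₁).2.symm, (Finset.mem_filter.mp h₂).2.symm⟩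
  · intro j
    rcases hmem j with h | h <;> rw [h]
    exact one_dvd 2

theorem mainTheorem10 (a b : Fin 4 → ℕ)
    (hb : Multiset.map b Finset.univ.val = {1, 1, 1, 2})
    (hab : ∀ i j : Fin 4, i ≤ j → ratioWeight a b j ≤ ratioWeight a b i) :
    ∃ D : Var → PrimeDivisor (weights a b),
      (∀ j, ((D j).1 : Set (Variety (weights a b))) = coordinateLocus (weights a b) j) ∧
      pseudoEffectiveCone (weights a b) =
        (PointedCone.hull ℝ {(D (Sum.inl 0)).numClass, (D (Sum.inr 3)).numClass} :
          Set (N1 (weights a b))) ∧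
      mobileCone (weights a b) =
        (PointedCone.hull ℝ {(D (Sum.inl 0)).numClass, (D (Sum.inr 2)).numClass} :
          Set (N1 (weights a b))) := by
  obtain ⟨⟨j₁, j₂, hj, h₁, h₂⟩, hb2⟩ := exists_ne_eq_one_and_forall_dvd_two hb
  have hb0 : ∀ j, b j ≠ 0 := fun j h => by simpa [h] using hb2 j
  have hle : ∀ {l n : Fin 4}, l ≤ n → b n * a l ≤ b l * a n := fun h =>
    mul_le_mul_of_ratioWeight_le (hb0 _) (hb0 _) (hab _ _ h)
  have : IsModuleTopology ℝ (N1 (weights a b)) := ⟨rfl⟩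
  refine ⟨coordinateDivisor (weights a b), coordinateDivisor_coe _, ?_, ?_⟩
  · have hhull : PointedCone.hull ℝ {c | ∃ D : WeilDivisor (weights a b), 0 ≤ D ∧ D.numClass = c} =
        PointedCone.hull ℝ {(coordinateDivisor (weights a b) (Sum.inl 0)).numClass,
          (coordinateDivisor (weights a b) (Sum.inr 3)).numClass} := by
      refine le_antisymm (Submodule.span_le.mpr ?_) (Submodule.span_mono ?_)
      · rintro _ ⟨D, hD, rfl⟩
        exact numClass_mem_hull_of_effective hj h₁ h₂ hb2 (fun l => hle (Fin.le_last l)) hD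
      · rintro _ (rfl | rfl)
        · exact ⟨_, single_nonneg _ zero_le_one, rfl⟩
        · exact ⟨_, single_nonneg _ zero_le_one, rfl⟩
    rw [pseudoEffectiveCone, hhull]
    exact (PointedCone.isClosed_hull_pair _ _).closure_eq
  · refine congrArg SetLike.coe (le_antisymm (Submodule.span_le.mpr ?_) (Submodule.span_mono ?_))
    · rintro _ ⟨D, hD, rfl⟩
      refine numClass_mem_hull_of_isMobile hj h₁ h₂ hb2 (fun l hl => hle ?_) hD
      omega
    · rintro _ (rfl | rfl)
      · exact ⟨_, isMobile_single_inl hj h₁ h₂, rfl⟩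
      · exact ⟨_, isMobile_single_inr hj h₁ h₂ (hb0 3) (hle (by decide)), rfl⟩
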